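/- Let $(W(a))_{a\in\mathcal H}$ be an isonormal Gaussian process over a real Hilbert space $\mathcal H$, and let $X_t=W(h_t)$, $t\in\mathbb Z$, be a centered stationary real Gaussian sequence with spectral density $f\in L^1(-\pi,\pi)$, that is, $\langle h_t,h_s\rangle_{\mathcal H}=\mathbb E[X_tX_s]=\int_{-\pi}^{\pi}e^{\mathrm i(t-s)\lambda}f(\lambda)\,\mathrm d\lambda$ for all $t,s\in\mathbb Z$, where $f$ is nonnegative and even almost everywhere. Let $g\in L^1(-\pi,\pi)$ be real and even almost everywhere. Assume that for $0<|\lambda|<\pi$ $$f(\lambda)=|\lambda|^{-\alpha}L_f(\lambda),\qquad g(\lambda)=|\lambda|^{-\beta}L_g(\lambda),\qquad -1<\alpha,\beta<1,\qquad d:=\alpha+\beta<\tfrac12,$$ where $L_f,L_g$ are slowly varying at $0$ (measurable, with $L(c\lambda)/L(\lambda)\to1$ as $\lambda\to0$ for every $c>0$), and that $f$ and $g$ are bounded on $\{\delta\le|\lambda|<\pi\}$ for every $\delta>0$. Let $$I_n(\lambda)=\frac1{2\pi n}\Big|\sum_{t=1}^nX_te^{\mathrm it\lambda}\Big|^2,\qquad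 F_n=\sqrt n\int_{-\pi}^{\pi}g(\lambda)\big(I_n(\lambda)-\mathbb E[I_n(\lambda)]\big)\,\mathrm d\lambda,$$ $$k_n=\frac1{2\pi\sqrt n}\sum_{t,s=1}^n\Big(\int_{-\pi}^{\pi}g(\lambda)e^{\mathrm i(t-s)\lambda}\,\mathrm d\lambda\Big)h_t\otimes h_s ,$$ and let $\otimes_1$ be the first contraction, the bilinear operation with $(a\otimes b)\otimes_1(c\otimes e)=\langle b,c\rangle_{\mathcal H}\,a\otimes e$. Let $I_2$ be the double Wiener–Itô integral, so that $I_2(a\otimes b)=W(a)W(b)-\langle a,b\rangle_{\mathcal H}$. Then $k_n$ is symmetric, $F_n=I_2(k_n)$ almost surely, $F_n\in L^4$, and $$\mathbb E[F_n^4]-3\,\mathbb E[F_n^2]^2=48\,\|k_n\otimes_1k_n\|_{\mathcal H^{\otimes2}}^2\quad\text{for every }n,\qquad \|k_n\otimes_1k_n\|_{\mathcal H^{\otimes2}}^2\longrightarrow0\quad(n\to\infty).$$ Assume moreover that there is $C>0$ such that, for all $\lambda,\omega\in(-\pi,\pi)$ with $|\lambda-\omega|<|\lambda|/2$, $$|f(\omega)-f(\lambda)|\le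 C f(\lambda)|\lambda|^{-1}|\lambda-\omega|,\qquad |g(\omega)-g(\lambda)|\le C g(\lambda)|\lambda|^{-1}|\lambda-\omega|.$$ Then for every $\eta>0$ there is $C_\eta<\infty$ such that, for all $n$ large enough, $$\|k_n\otimes_1k_n\|_{\mathcal H^{\otimes2}}^2\le C_\eta\,n^{2\max(d,0)-1+\eta};$$ in particular the bound is $C_\eta\,n^{2d-1+\eta}$ when $d\ge0$. -/

import Mathlib

open MeasureTheory ProbabilityTheory Filter Topology
open scoped TensorProduct ENNReal InnerProductSpace

noncomputable section

namespace IntegratedPeriodogram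

/-! ### Assumptions on the spectral density and on the weight -/

/-- `L` is slowly varying at `0`: it is Lebesgue measurable and `L (c x) / L x → 1` as `x → 0`,
`x ≠ 0`, for every `c > 0`. (The case `c = 1` says that `L` does not vanish near `0`.) -/
structure SlowlyVaryingAtZero (L : ℝ → ℝ) : Prop where
  aemeasurable : AEMeasurable L
  tendsto_ratio : ∀ c : ℝ, 0 < c → Tendsto (fun x => L (c * x) / L x) (𝓝[≠] 0) (𝓝 1)

/-- `u(x) = |x|^{-a} L(x)` on `(-π, π) \ {0}`, with `L` slowly varying at `0`. -/
structure PowerLawAtZero (u L : ℝ → ℝ) (a : ℝ) : Prop where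
  slowlyVarying : SlowlyVaryingAtZero L
  eq_rpow_mul : ∀ x ∈ Set.Ioo (-Real.pi) Real.pi, x ≠ 0 → u x = |x| ^ (-a) * L x

/-- `u` is (essentially) bounded on `{δ ≤ |x| < π}` for every `δ > 0`. -/
def BoundedAwayFromZero (u : ℝ → ℝ) : Prop :=
  ∀ δ : ℝ, 0 < δ → ∃ M : ℝ,
    ∀ᵐ x ∂(volume.restrict (Set.Ioo (-Real.pi) Real.pi)), δ ≤ |x| → |u x| ≤ M

/-- `u` is even almost everywhere on `(-π, π)`. -/
def EvenAE (u : ℝ → ℝ) : Prop :=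
  ∀ᵐ x ∂(volume.restrict (Set.Ioo (-Real.pi) Real.pi)), u (-x) = u x

/-- The local smoothness assumption
`|u(y) - u(x)| ≤ C u(x) |x|⁻¹ |x - y|` whenever `|x - y| < |x| / 2`. -/
def LocallySmooth (u : ℝ → ℝ) : Prop :=
  ∃ C : ℝ, 0 < C ∧ ∀ x ∈ Set.Ioo (-Real.pi) Real.pi, ∀ y ∈ Set.Ioo (-Real.pi) Real.pi,
    |x - y| < |x| / 2 → |u y - u x| ≤ C * u x * |x|⁻¹ * |x - y|

/-! ### The integrated periodogram -/

section Periodogram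

variable {Ω : Type*} [MeasurableSpace Ω]

/-- The discrete Fourier transform `d_n(x) = (2πn)^{-1/2} ∑_{t=1}^n X_t e^{i t x}`. -/
def dft (X : ℤ → Ω → ℝ) (n : ℕ) (x : ℝ) (ω : Ω) : ℂ :=
  ((1 / Real.sqrt (2 * Real.pi * n) : ℝ) : ℂ) *
    ∑ t ∈ Finset.Icc 1 n, (X (t : ℤ) ω : ℂ) * Complex.exp (Complex.I * (t : ℂ) * (x : ℂ))

/-- The periodogram `I_n(x) = |d_n(x)|²`. -/
def periodogram (X : ℤ → Ω → ℝ) (n : ℕ) (x : ℝ) (ω : Ω) : ℝ :=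
  ‖dft X n x ω‖ ^ 2

/-- The centered integrated periodogram
`F_n = √n ∫_{-π}^{π} g(x) (I_n(x) - E[I_n(x)]) dx`. -/
def integratedPeriodogram (P : Measure Ω) (X : ℤ → Ω → ℝ) (g : ℝ → ℝ) (n : ℕ) (ω : Ω) : ℝ :=
  Real.sqrt n * ∫ x in (-Real.pi)..Real.pi,
    g x * (periodogram X n x ω - ∫ ω', periodogram X n x ω' ∂P)

/-- The fourth cumulant `κ₄(F) = E[F⁴] - 3 E[F²]²` (of a centered random variable). -/
def fourthCumulant (P : Measure Ω) (F : Ω → ℝ) : ℝ :=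
  (∫ ω, F ω ^ 4 ∂P) - 3 * (∫ ω, F ω ^ 2 ∂P) ^ 2

end Periodogram

/-! ### Isonormal processes, the second Wiener chaos, the kernel and its contraction

All tensors below are finite sums of elementary tensors, hence live in the algebraic tensor
product `H ⊗ H`, on which Mathlib's inner product `⟪a ⊗ b, c ⊗ d⟫ = ⟪a, c⟫ ⟪b, d⟫` is that of its
completion, the Hilbert tensor square. -/

section Chaos

variable {H : Type*} [NormedAddCommGroup H] [InnerProductSpace ℝ H]

/-- The first contraction, the bilinear map with `(a ⊗ b) ⊗₁ (c ⊗ d) = ⟪b, c⟫ a ⊗ d`. -/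
def contraction : (H ⊗[ℝ] H) →ₗ[ℝ] (H ⊗[ℝ] H) →ₗ[ℝ] (H ⊗[ℝ] H) :=
  TensorProduct.lift <| LinearMap.mk₂ ℝ
    (fun a b => TensorProduct.lift <| LinearMap.mk₂ ℝ
      (fun c d => ⟪b, c⟫_ℝ • (a ⊗ₜ[ℝ] d))
      (fun c c' d => by rw [inner_add_right, add_smul])
      (fun r c d => by rw [inner_smul_right, mul_smul])
      (fun c d d' => by rw [TensorProduct.tmul_add, smul_add])
      (fun r c d => by rw [TensorProduct.tmul_smul, smul_comm]))
    (fun a a' b => by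
      ext c d
      simp [TensorProduct.add_tmul, smul_add])
    (fun r a b => by
      ext c d
      simp [TensorProduct.smul_tmul', smul_comm r])
    (fun a b b' => by
      ext c d
      simp [inner_add_left, add_smul])
    (fun r a b => by
      ext c d
      simp [inner_smul_left, mul_smul])

theorem contraction_tmul (a b c d : H) :
    contraction (a ⊗ₜ[ℝ] b) (c ⊗ₜ[ℝ] d) = ⟪b, c⟫_ℝ • (a ⊗ₜ[ℝ] d) := by
  simp [contraction]

/-- The Fourier coefficient `γ_g(k) = (2π)⁻¹ ∫_{-π}^{π} g(x) e^{i k x} dx`. -/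
def fourierCoeffOf (g : ℝ → ℝ) (k : ℤ) : ℂ :=
  (1 / (2 * Real.pi) : ℂ) *
    ∫ x in (-Real.pi)..Real.pi, (g x : ℂ) * Complex.exp (Complex.I * (k : ℂ) * (x : ℂ))

/-- The kernel
`k_n = (2π√n)⁻¹ ∑_{t,s=1}^n (∫_{-π}^{π} g(x) e^{i(t-s)x} dx) h_t ⊗ h_s`.
(The coefficients are real because `g` is even.) -/
def chaosKernel (h : ℤ → H) (g : ℝ → ℝ) (n : ℕ) : H ⊗[ℝ] H :=
  (1 / Real.sqrt n) • ∑ t ∈ Finset.Icc 1 n, ∑ s ∈ Finset.Icc 1 n,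
    (fourierCoeffOf g ((t : ℤ) - (s : ℤ))).re • (h (t : ℤ) ⊗ₜ[ℝ] h (s : ℤ))

variable {Ω : Type*} [MeasurableSpace Ω] {P : Measure Ω}

/-- An isonormal Gaussian process over `H`: a linear isometry `W : H → L²(P)` such that every
`W(a)` is a centered Gaussian variable with variance `‖a‖²`. By linearity the family is jointly
Gaussian, and `E[W(a) W(b)] = ⟪a, b⟫`. -/
def IsIsonormal (W : H →ₗᵢ[ℝ] Lp ℝ 2 P) : Prop :=
  ∀ a : H, P.map (W a : Ω → ℝ) = gaussianReal 0 (‖a‖₊ ^ 2)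

theorem aux_add_left (u u' v : Ω →ₘ[P] ℝ) (x x' : ℝ) :
    (u + u') * v - AEEqFun.const Ω (x + x') =
      (u * v - AEEqFun.const Ω x) + (u' * v - AEEqFun.const Ω x') := by
  induction u using AEEqFun.induction_on
  induction u' using AEEqFun.induction_on
  induction v using AEEqFun.induction_on
  simp only [AEEqFun.const, AEEqFun.mk_add_mk, AEEqFun.mk_mul_mk, ← AEEqFun.mk_sub]
  congr 1
  funext ω
  simp
  ring

theorem aux_smul_left (r : ℝ) (u v : Ω →ₘ[P] ℝ) (x : ℝ) :
    (r • u) * v - AEEqFun.const Ω (r * x) = r • (u * v - AEEqFun.const Ω x) := by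
  induction u using AEEqFun.induction_on
  induction v using AEEqFun.induction_on
  simp only [AEEqFun.const, AEEqFun.smul_mk, AEEqFun.mk_mul_mk, ← AEEqFun.mk_sub]
  congr 1
  funext ω
  simp
  ring

/-- The double Wiener–Itô integral, the linear map with `I₂(a ⊗ b) = W(a) W(b) - ⟪a, b⟫`. -/
def wienerIntegral₂ (W : H →ₗᵢ[ℝ] Lp ℝ 2 P) : (H ⊗[ℝ] H) →ₗ[ℝ] (Ω →ₘ[P] ℝ) :=
  TensorProduct.lift <| LinearMap.mk₂ ℝ
    (fun a b => (W a : Ω →ₘ[P] ℝ) * (W b : Ω →ₘ[P] ℝ) - AEEqFun.const Ω ⟪a, b⟫_ℝ)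
    (fun a a' b => by
      rw [map_add, AddSubgroup.coe_add, inner_add_left]
      exact aux_add_left _ _ _ _ _)
    (fun r a b => by
      rw [map_smul, inner_smul_left]
      exact aux_smul_left _ _ _ _)
    (fun a b b' => by
      rw [map_add, AddSubgroup.coe_add, inner_add_right, mul_comm, mul_comm (W a : Ω →ₘ[P] ℝ),
        mul_comm (W a : Ω →ₘ[P] ℝ)]
      exact aux_add_left _ _ _ _ _)
    (fun r a b => by
      rw [map_smul, inner_smul_right, mul_comm, mul_comm (W a : Ω →ₘ[P] ℝ)]
      exact aux_smul_left _ _ _ _)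

theorem wienerIntegral₂_tmul (W : H →ₗᵢ[ℝ] Lp ℝ 2 P) (a b : H) :
    wienerIntegral₂ W (a ⊗ₜ[ℝ] b) =
      (W a : Ω →ₘ[P] ℝ) * (W b : Ω →ₘ[P] ℝ) - AEEqFun.const Ω ⟪a, b⟫_ℝ := by
  simp [wienerIntegral₂]

end Chaos

end IntegratedPeriodogram

end

/-! The kernel `k_n` is a symmetric tensor of finite rank, so the spectral theorem gives `k_n = ∑ λᵢ
eᵢ ⊗ eᵢ` with `e` orthonormal in the span of `h_1, …, h_n` (`exists_diagonalization`). Then `F_n = ∑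
λᵢ (W(eᵢ)² - 1)` is a sum of independent centered variables. On such sums the fourth cumulant is
additive, and each `W(eᵢ)² - 1` has fourth cumulant 48, so `κ₄(F_n) = 48 ∑ λᵢ⁴`. Contracting squares
the eigenvalues, so `∑ λᵢ⁴` is also `‖k_n ⊗₁ k_n‖²`.

The size of the contraction comes from `∑ λᵢ⁴ ≤ (max λᵢ²) ∑ λᵢ²`, applied to the kernel without its
factor `(2π√n)⁻¹`. By a Potter-type bound, `f` and `g` are dominated by `|x|^(-a)` and `|x|^(-b)`
with `a > α` and `b > β` (`PowerLawAtZero.exists_abs_le`).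

Spectral norm: an eigenvalue is the Toeplitz form of `g` evaluated at a unit vector `e`. In the
frequency domain it is `∫ g |p|²`, where `p(y) = ∫ f(x) φ(x) D_n(x + y) dx`, `D_n` is the Dirichlet
kernel and `∫ f |φ|² = ‖e‖² = 1`. Schur's test with power weights bounds it by a multiple of
`n^(a+b)` (`exists_schur_bound`, `exists_quadratic_form_bound`).

Hilbert–Schmidt norm: `∑ λᵢ²` is bounded by a cyclic integral of four Dirichlet kernels.
Cauchy–Schwarz turns it into three integrals of `|D_n|^(4/3)`, each of order `n^(1/3)` up to a small
power, hence `n^(1+2ε)` in total (`exists_cyclic_bound`). This is where `a + b < 1/2` is needed.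

With the normalization `n^(-2)` the product has order `n^(2(a+b) - 1 + 2ε)`. Both arguments need `a
+ b > 0`; when `d < 0` the two exponents are raised by a common amount, which is why `max(d, 0)`
appears. The limit and the rate both follow from this estimate. -/

noncomputable section

namespace IntegratedPeriodogram

/-! ### Moments of Gaussian variables and fourth cumulants of independent sums -/

section Gaussian

/-- Evenness reduces the moment to a Gamma integral on the half-line, and `Γ(k + 1/2) = (2k-1)‼ √π /
2^k`. At `k = 0` the truncated subtraction gives `0‼ = 1`, the correct value. -/
theorem integral_pow_even_gaussianReal (k : ℕ) :
    ∫ x, x ^ (2 * k) ∂(gaussianReal 0 1) = ((2 * k - 1 : ℕ).doubleFactorial : ℝ) := by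
  have hpi : 0 < Real.pi := Real.pi_pos
  rw [integral_gaussianReal_eq_integral_smul one_ne_zero]
  set φ : ℝ → ℝ := fun y =>
    (√(2 * Real.pi))⁻¹ * (y ^ ((2 * k : ℕ) : ℝ) * Real.exp (-(1 / 2) * y ^ (2 : ℝ))) with hφ
  have h1 : ∀ x : ℝ, gaussianPDFReal 0 1 x • x ^ (2 * k) = φ |x| := by
    intro x
    simp only [hφ, gaussianPDFReal, smul_eq_mul, Real.rpow_natCast, Real.rpow_two, sq_abs, pow_mul]
    simp only [NNReal.coe_one, mul_one, sub_zero]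
    rw [show -x ^ 2 / 2 = -(1 / 2) * x ^ 2 by ring]
    ring
  rw [integral_congr_ae (ae_of_all _ h1), integral_comp_abs (f := φ), hφ, integral_const_mul,
    integral_rpow_mul_exp_neg_mul_rpow (by norm_num) (lt_of_lt_of_le (by norm_num) (Nat.cast_nonneg _))
      (by norm_num)]
  have h2 : (((2 * k : ℕ) : ℝ) + 1) / 2 = (k : ℝ) + 1 / 2 := by push_cast; ring
  rw [h2, Real.Gamma_nat_add_half]
  have h3 : (1 / 2 : ℝ) ^ (-((k : ℝ) + 1 / 2)) = 2 ^ k * √2 := by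
    rw [one_div, Real.inv_rpow (by norm_num), Real.rpow_neg (by norm_num), inv_inv,
      Real.rpow_add (by norm_num), Real.rpow_natCast, ← one_div, ← Real.sqrt_eq_rpow]
  have h4 : √(2 * Real.pi) = √2 * √Real.pi := Real.sqrt_mul (by norm_num) _
  rw [neg_div, h2, h3, h4]
  have h5 : √Real.pi ≠ 0 := (Real.sqrt_pos.2 hpi).ne'
  field_simp

variable {Ω : Type*} [MeasurableSpace Ω] {P : Measure Ω}

theorem fourthCumulant_congr {X Y : Ω → ℝ} (h : X =ᵐ[P] Y) :
    fourthCumulant P X = fourthCumulant P Y := by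
  unfold fourthCumulant
  have h2 : ∀ k : ℕ, ∫ ω, X ω ^ k ∂P = ∫ ω, Y ω ^ k ∂P := fun k =>
    integral_congr_ae (h.fun_comp (· ^ k))
  rw [h2, h2]

theorem integrable_pow_of_memLp_four [IsProbabilityMeasure P] {X : Ω → ℝ} (hX : MemLp X 4 P)
    {k : ℕ} (hk : k ≤ 4) : Integrable (fun ω => X ω ^ k) P := by
  have : MemLp X k P := hX.mono_exponent (by exact_mod_cast hk)
  have h := this.integrable_norm_pow'
  refine h.mono (this.1.pow k) (ae_of_all _ fun ω => ?_)
  simp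

/-- In `E[(X + Y)⁴]` the odd mixed terms vanish by centering, and the remaining `6 E[X²] E[Y²]` is
exactly the cross term of `3 (E[X²] + E[Y²])²`. -/
theorem fourthCumulant_add [IsProbabilityMeasure P] {X Y : Ω → ℝ} (hX : MemLp X 4 P)
    (hY : MemLp Y 4 P) (hX0 : ∫ ω, X ω ∂P = 0) (hY0 : ∫ ω, Y ω ∂P = 0) (hXY : IndepFun X Y P) :
    fourthCumulant P (X + Y) = fourthCumulant P X + fourthCumulant P Y := by
  have hXi : ∀ k ≤ 4, Integrable (fun ω => X ω ^ k) P := fun k hk => integrable_pow_of_memLp_four hX hk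
  have hYi : ∀ k ≤ 4, Integrable (fun ω => Y ω ^ k) P := fun k hk => integrable_pow_of_memLp_four hY hk
  have hind : ∀ j k : ℕ, IndepFun (fun ω => X ω ^ j) (fun ω => Y ω ^ k) P := fun j k =>
    hXY.comp (measurable_id.pow_const j) (measurable_id.pow_const k)
  have hmul : ∀ j k : ℕ, j ≤ 4 → k ≤ 4 →
      Integrable (fun ω => X ω ^ j * Y ω ^ k) P ∧
      ∫ ω, X ω ^ j * Y ω ^ k ∂P = (∫ ω, X ω ^ j ∂P) * ∫ ω, Y ω ^ k ∂P := fun j k hj hk =>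
    ⟨(hind j k).integrable_mul (hXi j hj) (hYi k hk),
      (hind j k).integral_fun_mul_eq_mul_integral (hXi j hj).1 (hYi k hk).1⟩
  have h2 : ∫ ω, (X + Y) ω ^ 2 ∂P = (∫ ω, X ω ^ 2 ∂P) + ∫ ω, Y ω ^ 2 ∂P := by
    have : ∀ ω, (X + Y) ω ^ 2 = X ω ^ 2 + 2 * (X ω ^ 1 * Y ω ^ 1) + Y ω ^ 2 := fun ω => by
      simp only [Pi.add_apply]; ring
    simp_rw [this]
    rw [integral_add ((hXi 2 (by norm_num)).fun_add ((hmul 1 1 (by norm_num) (by norm_num)).1.const_mul 2))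
      (hYi 2 (by norm_num)), integral_add (hXi 2 (by norm_num))
      ((hmul 1 1 (by norm_num) (by norm_num)).1.const_mul 2), integral_const_mul,
      (hmul 1 1 (by norm_num) (by norm_num)).2]
    simp [hX0]
  have h4 : ∫ ω, (X + Y) ω ^ 4 ∂P = (∫ ω, X ω ^ 4 ∂P) +
      6 * ((∫ ω, X ω ^ 2 ∂P) * ∫ ω, Y ω ^ 2 ∂P) + ∫ ω, Y ω ^ 4 ∂P := by
    have : ∀ ω, (X + Y) ω ^ 4 = X ω ^ 4 + 4 * (X ω ^ 3 * Y ω ^ 1) + 6 * (X ω ^ 2 * Y ω ^ 2)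
        + 4 * (X ω ^ 1 * Y ω ^ 3) + Y ω ^ 4 := fun ω => by
      simp only [Pi.add_apply]; ring
    simp_rw [this]
    have i0 := hXi 4 le_rfl
    have i1 := (hmul 3 1 (by norm_num) (by norm_num)).1.const_mul 4
    have i2 := (hmul 2 2 (by norm_num) (by norm_num)).1.const_mul 6
    have i3 := (hmul 1 3 (by norm_num) (by norm_num)).1.const_mul 4
    rw [integral_add (((i0.fun_add i1).fun_add i2).fun_add i3) (hYi 4 le_rfl), integral_add ((i0.fun_add i1).fun_add i2) i3,
      integral_add (i0.fun_add i1) i2, integral_add i0 i1, integral_const_mul, integral_const_mul,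
      integral_const_mul, (hmul 3 1 (by norm_num) (by norm_num)).2,
      (hmul 2 2 (by norm_num) (by norm_num)).2, (hmul 1 3 (by norm_num) (by norm_num)).2]
    simp [hX0, hY0]
  unfold fourthCumulant
  rw [h2, h4]
  ring

theorem fourthCumulant_const_mul (c : ℝ) (X : Ω → ℝ) :
    fourthCumulant P (fun ω => c * X ω) = c ^ 4 * fourthCumulant P X := by
  simp only [fourthCumulant, mul_pow, integral_const_mul]
  ring

theorem fourthCumulant_sum [IsProbabilityMeasure P] {ι : Type*} {X : ι → Ω → ℝ}
    (hX : ∀ i, MemLp (X i) 4 P) (hX0 : ∀ i, ∫ ω, X i ω ∂P = 0) (hind : iIndepFun X P)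
    (s : Finset ι) :
    MemLp (∑ i ∈ s, X i) 4 P ∧ ∫ ω, (∑ i ∈ s, X i) ω ∂P = 0 ∧
      fourthCumulant P (∑ i ∈ s, X i) = ∑ i ∈ s, fourthCumulant P (X i) := by
  classical
  induction s using Finset.induction_on with
  | empty => simp [fourthCumulant, MemLp.zero]
  | insert i s hi ih =>
    obtain ⟨h1, h2, h3⟩ := ih
    have hI := hind.indepFun_finsetSum_of_notMem₀ (fun i => (hX i).1.aemeasurable) hi
    rw [Finset.sum_insert hi, Finset.sum_insert hi, add_comm, add_comm (fourthCumulant P (X i))]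
    refine ⟨h1.add (hX i), ?_, ?_⟩
    · simp only [Pi.add_apply]
      rw [integral_add (h1.integrable (by norm_num)) ((hX i).integrable (by norm_num)), h2, hX0,
        add_zero]
    · rw [fourthCumulant_add h1 (hX i) h2 (hX0 i) hI, h3]

/-- The second Hermite polynomial of a standard Gaussian variable: it is in `L⁴`, centered, and its
fourth cumulant is `48`. -/
theorem hermite_two_gaussian [IsProbabilityMeasure P] {X : Ω → ℝ} (hXm : AEMeasurable X P)
    (hX : P.map X = gaussianReal 0 1) :
    MemLp (fun ω => X ω ^ 2 - 1) 4 P ∧ ∫ ω, (X ω ^ 2 - 1) ∂P = 0 ∧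
      fourthCumulant P (fun ω => X ω ^ 2 - 1) = 48 := by
  have hint : ∀ k : ℕ, Integrable (fun x : ℝ => x ^ k) (gaussianReal 0 1) := fun k => by
    have h : MemLp id (k : ℝ≥0∞) (gaussianReal 0 1) := memLp_id_gaussianReal' k (by simp)
    refine h.integrable_norm_pow'.mono (by fun_prop) (ae_of_all _ fun x => ?_)
    simp
  have hmem : MemLp (fun x : ℝ => x ^ 2 - 1) 4 (gaussianReal 0 1) := by
    have h1 : MemLp (fun x : ℝ => x ^ 2 - 1) (4 : ℕ) (gaussianReal 0 1) := by
      rw [← integrable_norm_rpow_iff (by fun_prop) (by norm_num) (by norm_num)]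
      have : ∀ x : ℝ, ‖x ^ 2 - 1‖ ^ ((4 : ℕ) : ℝ≥0∞).toReal = x ^ 8 - 4 * x ^ 6 + 6 * x ^ 4 - 4 * x ^ 2 + 1 := fun x => by
        rw [ENNReal.toReal_natCast, Real.rpow_natCast, Real.norm_eq_abs, Even.pow_abs (by decide)]; ring
      simp_rw [this]
      exact ((((hint 8).sub ((hint 6).const_mul 4)).fun_add ((hint 4).const_mul 6)).sub
        ((hint 2).const_mul 4)).fun_add (integrable_const _)
    exact_mod_cast h1
  have m2 : ∫ x, x ^ 2 ∂(gaussianReal 0 1) = 1 := by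
    simpa using integral_pow_even_gaussianReal 1
  have m4 : ∫ x, x ^ 4 ∂(gaussianReal 0 1) = 3 := by
    simpa [Nat.doubleFactorial] using integral_pow_even_gaussianReal 2
  have m6 : ∫ x, x ^ 6 ∂(gaussianReal 0 1) = 15 := by
    simpa [Nat.doubleFactorial] using integral_pow_even_gaussianReal 3
  have m8 : ∫ x, x ^ 8 ∂(gaussianReal 0 1) = 105 := by
    simpa [Nat.doubleFactorial] using integral_pow_even_gaussianReal 4
  have htr : ∀ φ : ℝ → ℝ, Continuous φ → ∫ ω, φ (X ω) ∂P = ∫ x, φ x ∂(gaussianReal 0 1) :=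
    fun φ hφ => by rw [← hX, integral_map hXm hφ.aestronglyMeasurable]
  refine ⟨?_, ?_, ?_⟩
  · rw [← hX] at hmem
    exact (memLp_map_measure_iff (by fun_prop) hXm).1 hmem
  · rw [htr (fun x => x ^ 2 - 1) (by fun_prop), integral_sub (hint 2) (integrable_const _), m2]
    simp
  · unfold fourthCumulant
    rw [htr (fun x => (x ^ 2 - 1) ^ 4) (by fun_prop), htr (fun x => (x ^ 2 - 1) ^ 2) (by fun_prop)]
    have e4 : ∀ x : ℝ, (x ^ 2 - 1) ^ 4 = x ^ 8 - 4 * x ^ 6 + 6 * x ^ 4 - 4 * x ^ 2 + 1 :=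
      fun x => by ring
    have e2 : ∀ x : ℝ, (x ^ 2 - 1) ^ 2 = x ^ 4 - 2 * x ^ 2 + 1 := fun x => by ring
    simp_rw [e4, e2]
    have a1 : Integrable (fun x : ℝ => x ^ 8 - 4 * x ^ 6) (gaussianReal 0 1) :=
      (hint 8).sub ((hint 6).const_mul 4)
    have a2 : Integrable (fun x : ℝ => x ^ 8 - 4 * x ^ 6 + 6 * x ^ 4) (gaussianReal 0 1) :=
      a1.fun_add ((hint 4).const_mul 6)
    have a3 : Integrable (fun x : ℝ => x ^ 8 - 4 * x ^ 6 + 6 * x ^ 4 - 4 * x ^ 2) (gaussianReal 0 1) :=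
      a2.sub ((hint 2).const_mul 4)
    have b1 : Integrable (fun x : ℝ => x ^ 4 - 2 * x ^ 2) (gaussianReal 0 1) :=
      (hint 4).sub ((hint 2).const_mul 2)
    rw [integral_add a3 (integrable_const _), integral_sub a2 ((hint 2).const_mul 4),
      integral_add a1 ((hint 4).const_mul 6), integral_sub (hint 8) ((hint 6).const_mul 4),
      integral_add b1 (integrable_const _), integral_sub (hint 4) ((hint 2).const_mul 2)]
    -- The moments are `105 - 60 + 18 - 4 + 1 = 60` and `3 - 2 + 1 = 2`, and `60 - 3 · 2² = 48`.
    simp only [integral_const_mul, m2, m4, m6, m8, integral_const]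
    norm_num

variable {H : Type*} [NormedAddCommGroup H] [InnerProductSpace ℝ H]

/-- By linearity `∑ tᵢ W(eᵢ) = W(∑ tᵢ eᵢ)` is Gaussian with variance `∑ tᵢ²`, so the joint
characteristic function factorizes. -/
theorem IsIsonormal.iIndepFun_of_orthonormal [IsProbabilityMeasure P] {W : H →ₗᵢ[ℝ] Lp ℝ 2 P}
    (hW : IsIsonormal W) {ι : Type*} [Fintype ι] {e : ι → H} (he : Orthonormal ℝ e) :
    iIndepFun (fun i => (W (e i) : Ω → ℝ)) P := by
  have hm : ∀ a : H, AEMeasurable (W a : Ω → ℝ) P := fun a =>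
    (Lp.aestronglyMeasurable (W a)).aemeasurable
  rw [iIndepFun_iff_charFun_pi fun i => hm (e i)]
  intro t
  have hvec : AEMeasurable (fun ω => WithLp.toLp 2 fun i => (W (e i) : Ω → ℝ) ω) P := by
    have : AEMeasurable (fun ω => fun i => (W (e i) : Ω → ℝ) ω) P := aemeasurable_pi_lambda _ fun i => hm (e i)
    exact (WithLp.measurable_toLp 2 (ι → ℝ)).comp_aemeasurable this
  have hlin : (W (∑ i, t i • e i) : Ω → ℝ) =ᵐ[P] fun ω => ∑ i, t i * (W (e i) : Ω → ℝ) ω := by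
    rw [map_sum]
    refine (Lp.coeFn_fun_finsetSum _ _).trans ?_
    have : ∀ i, (W (t i • e i) : Ω → ℝ) =ᵐ[P] fun ω => t i * (W (e i) : Ω → ℝ) ω := fun i => by
      rw [map_smul]
      exact Lp.coeFn_smul _ _
    filter_upwards [ae_all_iff.2 this] with ω hω
    simp only [hω]
  have hnorm : ‖∑ i, t i • e i‖ ^ 2 = ∑ i, t i ^ 2 := by
    rw [← real_inner_self_eq_norm_sq, he.inner_sum]
    simp [sq]
  have h1 : charFun (P.map (fun ω => WithLp.toLp 2 fun i => (W (e i) : Ω → ℝ) ω)) t =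
      charFun (P.map (W (∑ i, t i • e i) : Ω → ℝ)) 1 := by
    rw [charFun_apply, charFun_apply, integral_map hvec (by fun_prop), integral_map (hm _) (by fun_prop)]
    refine integral_congr_ae ?_
    filter_upwards [hlin] with ω hω
    rw [hω]
    simp [PiLp.inner_apply]
  rw [h1, hW, charFun_gaussianReal]
  simp_rw [hW (e _), charFun_gaussianReal, ← Complex.exp_sum]
  congr 1
  have h2 : (((‖∑ i, t i • e i‖₊ ^ 2 : NNReal) : ℝ) : ℂ) = ∑ i, (t i : ℂ) ^ 2 := by
    rw [NNReal.coe_pow, coe_nnnorm, hnorm]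
    push_cast
    rfl
  have h3 : ∀ i, ‖e i‖₊ = 1 := fun i => NNReal.eq (he.1 i)
  rw [h2]
  simp [h3, Finset.sum_div]

end Gaussian

/-! ### Diagonalization of symmetric tensors -/

section Diagonalization

variable {H : Type*} [NormedAddCommGroup H] [InnerProductSpace ℝ H]

theorem sum_sum_comm {ι κ M : Type*} [Fintype ι] [Fintype κ] [AddCommMonoid M]
    (G : ι → ι → κ → κ → M) :
    ∑ t, ∑ s, ∑ i, ∑ j, G t s i j = ∑ i, ∑ j, ∑ t, ∑ s, G t s i j :=
  calc _ = ∑ t, ∑ i, ∑ s, ∑ j, G t s i j := Finset.sum_congr rfl fun _ _ => Finset.sum_comm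
    _ = ∑ i, ∑ t, ∑ s, ∑ j, G t s i j := Finset.sum_comm
    _ = ∑ i, ∑ t, ∑ j, ∑ s, G t s i j := Finset.sum_congr rfl fun _ _ =>
        Finset.sum_congr rfl fun _ _ => Finset.sum_comm
    _ = _ := Finset.sum_congr rfl fun _ _ => Finset.sum_comm

/-- A symmetric tensor of finite rank is diagonal in some orthonormal system. -/
theorem exists_diagonalization {ι : Type*} [Fintype ι] (v : ι → H) (B : ι → ι → ℝ)
    (hB : ∀ t s, B t s = B s t) :
    ∃ (m : ℕ) (e : Fin m → H) (lam : Fin m → ℝ), Orthonormal ℝ e ∧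
      (∀ i, e i ∈ Submodule.span ℝ (Set.range v)) ∧
      ∑ t, ∑ s, B t s • (v t ⊗ₜ[ℝ] v s) = ∑ i, lam i • (e i ⊗ₜ[ℝ] e i) := by
  set V := Submodule.span ℝ (Set.range v) with hV
  have : FiniteDimensional ℝ V := FiniteDimensional.span_of_finite ℝ (Set.finite_range v)
  let w : ι → V := fun t => ⟨v t, Submodule.subset_span ⟨t, rfl⟩⟩
  -- `T` is the operator on the span with tensor `∑ B t s • v t ⊗ v s`; symmetry of `B` makes it
  -- self-adjoint, and its eigenbasis is the required system.
  let T : V →ₗ[ℝ] V := ∑ t, ∑ s, B t s • (innerₛₗ ℝ (w s)).smulRight (w t)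
  have hT_apply : ∀ x, T x = ∑ t, ∑ s, (B t s * ⟪w s, x⟫_ℝ) • w t := fun x => by
    simp [T, LinearMap.sum_apply, smul_smul]
  have hT_inner : ∀ x y, ⟪x, T y⟫_ℝ = ∑ t, ∑ s, B t s * ⟪w t, x⟫_ℝ * ⟪w s, y⟫_ℝ := fun x y => by
    rw [hT_apply, inner_sum]
    refine Finset.sum_congr rfl fun t _ => ?_
    rw [inner_sum]
    refine Finset.sum_congr rfl fun s _ => ?_
    rw [inner_smul_right, real_inner_comm x]
    ring
  have hT : T.IsSymmetric := fun x y => by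
    rw [real_inner_comm, hT_inner, hT_inner, Finset.sum_comm]
    refine Finset.sum_congr rfl fun t _ => Finset.sum_congr rfl fun s _ => ?_
    rw [hB]
    ring
  let b := hT.eigenvectorBasis rfl
  let lam := hT.eigenvalues rfl
  have hw : ∀ t, v t = ∑ i, ⟪b i, w t⟫_ℝ • (b i : H) := fun t => by
    have := congrArg (Subtype.val) (b.sum_repr' (w t))
    rw [← Submodule.coe_subtype, map_sum] at this
    simpa using this.symm
  refine ⟨Module.finrank ℝ V, fun i => (b i : H), lam, ?_, fun i => (b i).2, ?_⟩
  · exact b.orthonormal.comp_linearIsometry V.subtypeₗᵢ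
  -- The coefficient of `b i ⊗ b j` in the tensor is `⟪b i, T (b j)⟫`, which is diagonal in an
  -- eigenbasis.
  · have hcoef : ∀ i j, ∑ t, ∑ s, B t s * ⟪b i, w t⟫_ℝ * ⟪b j, w s⟫_ℝ = if i = j then lam i else 0 := by
      intro i j
      have h1 := hT_inner (b i) (b j)
      rw [hT.apply_eigenvectorBasis, inner_smul_right] at h1
      have h2 : ⟪b i, b j⟫_ℝ = if i = j then 1 else 0 := orthonormal_iff_ite.1 b.orthonormal i j
      change (hT.eigenvalues rfl j : ℝ) * ⟪b i, b j⟫_ℝ = _ at h1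
      rw [h2] at h1
      simp_rw [real_inner_comm (w _) (b _)]
      rw [← h1]
      split_ifs with h
      · subst h; simp [lam]
      · simp
    calc ∑ t, ∑ s, B t s • (v t ⊗ₜ[ℝ] v s)
        = ∑ t, ∑ s, ∑ i, ∑ j, (B t s * ⟪b i, w t⟫_ℝ * ⟪b j, w s⟫_ℝ) • ((b i : H) ⊗ₜ[ℝ] (b j : H)) := by
          refine Finset.sum_congr rfl fun t _ => Finset.sum_congr rfl fun s _ => ?_
          rw [hw t, hw s, TensorProduct.sum_tmul, Finset.smul_sum]
          refine Finset.sum_congr rfl fun i _ => ?_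
          rw [TensorProduct.tmul_sum, Finset.smul_sum]
          refine Finset.sum_congr rfl fun j _ => ?_
          rw [TensorProduct.smul_tmul_smul, smul_smul, mul_assoc]
      _ = ∑ i, ∑ j, (∑ t, ∑ s, B t s * ⟪b i, w t⟫_ℝ * ⟪b j, w s⟫_ℝ) • ((b i : H) ⊗ₜ[ℝ] (b j : H)) := by
          simp_rw [Finset.sum_smul]
          exact sum_sum_comm _
      _ = _ := by
          refine Finset.sum_congr rfl fun i _ => ?_
          simp_rw [hcoef, ite_smul, zero_smul]
          simp

theorem tensor_inner_smul_left (r : ℝ) (x y : H ⊗[ℝ] H) : ⟪r • x, y⟫_ℝ = r * ⟪x, y⟫_ℝ :=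
  real_inner_smul_left x y r

theorem tensor_inner_smul_right (r : ℝ) (x y : H ⊗[ℝ] H) : ⟪x, r • y⟫_ℝ = r * ⟪x, y⟫_ℝ :=
  real_inner_smul_right x y r

variable {m : ℕ} {e : Fin m → H}

theorem inner_diagonal_diagonal (he : Orthonormal ℝ e) (a b : Fin m → ℝ) :
    ⟪∑ i, a i • (e i ⊗ₜ[ℝ] e i), ∑ i, b i • (e i ⊗ₜ[ℝ] e i)⟫_ℝ = ∑ i, a i * b i := by
  have h := orthonormal_iff_ite.1 he
  simp only [sum_inner, inner_sum, tensor_inner_smul_left, tensor_inner_smul_right, TensorProduct.inner_tmul, h]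
  simp [mul_comm]

theorem norm_sq_diagonal (he : Orthonormal ℝ e) (a : Fin m → ℝ) :
    ‖∑ i, a i • (e i ⊗ₜ[ℝ] e i)‖ ^ 2 = ∑ i, a i ^ 2 := by
  rw [← real_inner_self_eq_norm_sq, inner_diagonal_diagonal he]
  simp [sq]

theorem contraction_diagonal (he : Orthonormal ℝ e) (a : Fin m → ℝ) :
    contraction (∑ i, a i • (e i ⊗ₜ[ℝ] e i)) (∑ i, a i • (e i ⊗ₜ[ℝ] e i)) =
      ∑ i, a i ^ 2 • (e i ⊗ₜ[ℝ] e i) := by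
  have h := orthonormal_iff_ite.1 he
  simp only [map_sum, LinearMap.sum_apply, map_smul, LinearMap.smul_apply, contraction_tmul, h]
  simp [smul_smul, sq]

theorem norm_sq_contraction_diagonal (he : Orthonormal ℝ e) (a : Fin m → ℝ) :
    ‖contraction (∑ i, a i • (e i ⊗ₜ[ℝ] e i)) (∑ i, a i • (e i ⊗ₜ[ℝ] e i))‖ ^ 2 =
      ∑ i, a i ^ 4 := by
  rw [contraction_diagonal he, norm_sq_diagonal he]
  refine Finset.sum_congr rfl fun i _ => ?_
  ring

theorem inner_tmul_self_diagonal (he : Orthonormal ℝ e) (a : Fin m → ℝ) (i : Fin m) :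
    ⟪e i ⊗ₜ[ℝ] e i, ∑ j, a j • (e j ⊗ₜ[ℝ] e j)⟫_ℝ = a i := by
  have h := orthonormal_iff_ite.1 he
  simp only [inner_sum, tensor_inner_smul_right, TensorProduct.inner_tmul, h]
  simp

variable {Ω : Type*} [MeasurableSpace Ω] {P : Measure Ω}

theorem wienerIntegral₂_tmul_ae (W : H →ₗᵢ[ℝ] Lp ℝ 2 P) (a b : H) :
    (wienerIntegral₂ W (a ⊗ₜ[ℝ] b) : Ω → ℝ) =ᵐ[P]
      fun ω => (W a : Ω → ℝ) ω * (W b : Ω → ℝ) ω - ⟪a, b⟫_ℝ := by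
  rw [wienerIntegral₂_tmul]
  filter_upwards [AEEqFun.coeFn_sub ((W a : Ω →ₘ[P] ℝ) * (W b : Ω →ₘ[P] ℝ))
    (AEEqFun.const Ω ⟪a, b⟫_ℝ), AEEqFun.coeFn_mul (W a : Ω →ₘ[P] ℝ) (W b : Ω →ₘ[P] ℝ),
    AEEqFun.coeFn_const Ω (μ := P) ⟪a, b⟫_ℝ] with ω h1 h2 h3
  rw [h1, Pi.sub_apply, h2, h3]
  rfl

theorem coeFn_aeEqFun_sum {ι : Type*} (s : Finset ι) (u : ι → Ω →ₘ[P] ℝ) :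
    ((∑ i ∈ s, u i : Ω →ₘ[P] ℝ) : Ω → ℝ) =ᵐ[P] fun ω => ∑ i ∈ s, u i ω := by
  classical
  induction s using Finset.induction_on with
  | empty => simpa using! AEEqFun.coeFn_zero (μ := P) (β := ℝ)
  | insert i s hi ih =>
    rw [Finset.sum_insert hi]
    filter_upwards [AEEqFun.coeFn_add (u i) (∑ j ∈ s, u j), ih] with ω h1 h2
    rw [h1, Pi.add_apply, h2, Finset.sum_insert hi]

/-- The double integral of a finite linear combination of elementary tensors. -/
theorem wienerIntegral₂_sum_ae (W : H →ₗᵢ[ℝ] Lp ℝ 2 P) {ι : Type*} (s : Finset ι) (c : ι → ℝ)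
    (a b : ι → H) :
    (wienerIntegral₂ W (∑ i ∈ s, c i • (a i ⊗ₜ[ℝ] b i)) : Ω → ℝ) =ᵐ[P]
      fun ω => ∑ i ∈ s, c i * ((W (a i) : Ω → ℝ) ω * (W (b i) : Ω → ℝ) ω - ⟪a i, b i⟫_ℝ) := by
  rw [map_sum]
  have h : ∀ i ∈ s, (wienerIntegral₂ W (c i • (a i ⊗ₜ[ℝ] b i)) : Ω → ℝ) =ᵐ[P]
      fun ω => c i * ((W (a i) : Ω → ℝ) ω * (W (b i) : Ω → ℝ) ω - ⟪a i, b i⟫_ℝ) := fun i _ => by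
    rw [map_smul]
    filter_upwards [AEEqFun.coeFn_smul (c i) (wienerIntegral₂ W (a i ⊗ₜ[ℝ] b i)),
      wienerIntegral₂_tmul_ae W (a i) (b i)] with ω h1 h2
    rw [h1, Pi.smul_apply, h2, smul_eq_mul]
  filter_upwards [coeFn_aeEqFun_sum s fun i => wienerIntegral₂ W (c i • (a i ⊗ₜ[ℝ] b i)),
    (Finset.eventually_all s).2 h] with ω h1 h2
  rw [h1]
  exact Finset.sum_congr rfl h2

/-- Fourth cumulant of a double integral with diagonal kernel. -/
theorem fourthCumulant_wienerIntegral₂_diagonal [IsProbabilityMeasure P] {W : H →ₗᵢ[ℝ] Lp ℝ 2 P}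
    (hW : IsIsonormal W) (he : Orthonormal ℝ e) (a : Fin m → ℝ) :
    MemLp (wienerIntegral₂ W (∑ i, a i • (e i ⊗ₜ[ℝ] e i)) : Ω → ℝ) 4 P ∧
      fourthCumulant P (wienerIntegral₂ W (∑ i, a i • (e i ⊗ₜ[ℝ] e i))) = 48 * ∑ i, a i ^ 4 := by
  have hm : ∀ a : H, AEMeasurable (W a : Ω → ℝ) P := fun a =>
    (Lp.aestronglyMeasurable (W a)).aemeasurable
  let Y : Fin m → Ω → ℝ := fun i ω => a i * ((W (e i) : Ω → ℝ) ω ^ 2 - 1)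
  have hY : ∀ i, MemLp (Y i) 4 P ∧ ∫ ω, Y i ω ∂P = 0 ∧ fourthCumulant P (Y i) = a i ^ 4 * 48 := by
    intro i
    have hlaw : P.map (W (e i) : Ω → ℝ) = gaussianReal 0 1 := by
      rw [hW (e i), show ‖e i‖₊ = 1 from NNReal.eq (he.1 i), one_pow]
    obtain ⟨h1, h2, h3⟩ := hermite_two_gaussian (hm (e i)) hlaw
    refine ⟨h1.const_mul (a i), ?_, ?_⟩
    · simp only [Y, integral_const_mul, h2, mul_zero]
    · rw [← h3]; exact fourthCumulant_const_mul _ _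
  have hind : iIndepFun Y P :=
    (hW.iIndepFun_of_orthonormal he).comp (fun i x => a i * (x ^ 2 - 1)) fun i => by fun_prop
  obtain ⟨h1, -, h3⟩ := fourthCumulant_sum (fun i => (hY i).1) (fun i => (hY i).2.1) hind Finset.univ
  have hae : (wienerIntegral₂ W (∑ i, a i • (e i ⊗ₜ[ℝ] e i)) : Ω → ℝ) =ᵐ[P] ∑ i, Y i := by
    filter_upwards [wienerIntegral₂_sum_ae W Finset.univ a e e] with ω hω
    rw [hω, Finset.sum_apply]
    refine Finset.sum_congr rfl fun i _ => ?_
    simp [Y, he.1 i, sq]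
  refine ⟨(memLp_congr_ae hae).2 h1, ?_⟩
  rw [fourthCumulant_congr hae, h3, Finset.mul_sum]
  exact Finset.sum_congr rfl fun i _ => by rw [(hY i).2.2, mul_comm]

end Diagonalization

/-! ### Integrals of power functions on the line -/

section PowerIntegrals

theorem ennreal_rpow_le_rpow_of_nonpos {x y : ℝ≥0∞} {z : ℝ} (h : x ≤ y) (hz : z ≤ 0) :
    y ^ z ≤ x ^ z := by
  have hz' : 0 ≤ -z := by linarith
  rw [← neg_neg z, ENNReal.rpow_neg, ENNReal.rpow_neg x]
  exact ENNReal.inv_le_inv.2 (ENNReal.rpow_le_rpow h hz')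

theorem enorm_le_enorm_of_abs_le {x y : ℝ} (h : |x| ≤ |y|) : ‖x‖ₑ ≤ ‖y‖ₑ := by
  rw [← ofReal_norm, ← ofReal_norm]
  exact ENNReal.ofReal_le_ofReal h

theorem enorm_rpow_eq_ofReal {x : ℝ} (hx : x ≠ 0) (p : ℝ) :
    ‖x‖ₑ ^ p = ENNReal.ofReal (|x| ^ p) := by
  rw [← ofReal_norm, ENNReal.ofReal_rpow_of_pos (norm_pos_iff.2 hx), Real.norm_eq_abs]

theorem enorm_rpow_add {x : ℝ} (hx : x ≠ 0) (p q : ℝ) : ‖x‖ₑ ^ (p + q) = ‖x‖ₑ ^ p * ‖x‖ₑ ^ q :=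
  ENNReal.rpow_add _ _ (enorm_ne_zero.2 hx) enorm_ne_top

theorem ae_ne_zero_real (μ : Measure ℝ) [NullSingletonClass μ] : ∀ᵐ x ∂μ, x ≠ (0 : ℝ) := by
  simp [ae_iff]

theorem lintegral_enorm_rpow_lt_top {q : ℝ} (hq : q < 1) (R : ℝ) :
    ∫⁻ y in Set.Icc (-R) R, ‖y‖ₑ ^ (-q) < ⊤ := by
  have h1 : IntegrableOn (fun y : ℝ => ‖y‖ ^ (-q)) (Metric.ball (0 : ℝ) (R + 1)) := by
    rw [integrableOn_fun_norm_addHaar volume (f := fun t : ℝ => t ^ (-q))]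
    simp only [Module.finrank_self, tsub_self, pow_zero, one_smul]
    by_cases hR : 0 < R + 1
    · exact (intervalIntegral.integrableOn_Ioo_rpow_iff hR).2 (by linarith)
    · simp [Set.Ioo_eq_empty_of_le (not_lt.1 hR)]
  have h2 : ∫⁻ y in Metric.ball (0 : ℝ) (R + 1), ‖y‖ₑ ^ (-q) =
      ∫⁻ y in Metric.ball (0 : ℝ) (R + 1), ENNReal.ofReal (‖y‖ ^ (-q)) := by
    refine lintegral_congr_ae ?_
    filter_upwards [ae_ne_zero_real (volume.restrict (Metric.ball (0 : ℝ) (R + 1)))] with y hy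
    exact enorm_rpow_eq_ofReal hy _
  have h3 : Set.Icc (-R) R ⊆ Metric.ball (0 : ℝ) (R + 1) := fun y hy => by
    rw [mem_ball_zero_iff, Real.norm_eq_abs]
    exact (abs_le.2 hy).trans_lt (by linarith)
  refine (lintegral_mono_set h3).trans_lt ?_
  rw [h2]
  exact h1.lintegral_lt_top

theorem lintegral_enorm_rpow_tail_lt_top {p : ℝ} (hp : 1 < p) {R : ℝ} (hR : 0 < R) :
    ∫⁻ y in {y : ℝ | R < |y|}, ‖y‖ₑ ^ (-p) < ⊤ := by
  have hs : MeasurableSet {y : ℝ | R < |y|} := measurableSet_lt measurable_const measurable_norm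
  have h1 : Integrable (fun y : ℝ => (Set.Ioi R).indicator (fun t : ℝ => t ^ (-p)) ‖y‖) := by
    rw [integrable_fun_norm_addHaar volume (f := (Set.Ioi R).indicator (fun t : ℝ => t ^ (-p)))]
    simp only [Module.finrank_self, tsub_self, pow_zero, one_smul]
    exact ((integrable_indicator_iff measurableSet_Ioi).2
      (integrableOn_Ioi_rpow_of_lt (by linarith) hR)).integrableOn
  have h2 : IntegrableOn (fun y : ℝ => |y| ^ (-p)) {y : ℝ | R < |y|} := by
    rw [← integrable_indicator_iff hs]
    exact h1
  have h3 : ∫⁻ y in {y : ℝ | R < |y|}, ‖y‖ₑ ^ (-p) =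
      ∫⁻ y in {y : ℝ | R < |y|}, ENNReal.ofReal (|y| ^ (-p)) := by
    refine setLIntegral_congr_fun hs fun y hy => enorm_rpow_eq_ofReal ?_ _
    rintro rfl
    simp at hy
    linarith
  rw [h3]
  exact h2.lintegral_lt_top

/-- The line is split into neighborhoods of `0` and of `1`, where `r < 1` and `s < 1` give
integrability, and a remainder where `r + s > 1` gives decay. The hypotheses force `r, s > 0`, so
powers with exponents `-r` and `-s` are decreasing. -/
theorem lintegral_two_singularities_lt_top {r s : ℝ} (hr : r < 1) (hs : s < 1) (hrs : 1 < r + s) :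
    ∫⁻ y : ℝ, ‖y‖ₑ ^ (-r) * ‖y - 1‖ₑ ^ (-s) < ⊤ := by
  have hhalf : ‖(1 / 2 : ℝ)‖ₑ ≠ 0 := enorm_ne_zero.2 (by norm_num)
  have hthird : ‖(1 / 3 : ℝ)‖ₑ ≠ 0 := enorm_ne_zero.2 (by norm_num)
  have hfin : ∀ (z : ℝ) {c : ℝ}, ‖c‖ₑ ≠ 0 → ‖c‖ₑ ^ z ≠ ⊤ := fun z c hc =>
    ENNReal.rpow_ne_top_of_ne_zero hc enorm_ne_top
  have hI1 := lintegral_enorm_rpow_lt_top hr (1 / 2)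
  have hI2 := lintegral_enorm_rpow_lt_top hs (1 / 2)
  have hI3 := lintegral_enorm_rpow_tail_lt_top hrs (R := 1 / 2) (by norm_num)
  have hm : ∀ p : ℝ, Measurable fun y : ℝ => ‖y‖ₑ ^ (-p) := fun p => by fun_prop
  set A := Set.Icc (-(1 / 2) : ℝ) (1 / 2)
  have hA : MeasurableSet A := measurableSet_Icc
  set T := {y : ℝ | 1 / 2 < |y|}
  have hT : MeasurableSet T := measurableSet_lt measurable_const measurable_norm
  have hI2' : ∫⁻ y : ℝ, A.indicator (fun y => ‖y‖ₑ ^ (-s)) (y - 1) < ⊤ := by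
    rw [lintegral_sub_right_eq_self (A.indicator fun y : ℝ => ‖y‖ₑ ^ (-s)) 1, lintegral_indicator hA]
    exact hI2
  have hpt : ∀ y : ℝ, ‖y‖ₑ ^ (-r) * ‖y - 1‖ₑ ^ (-s) ≤
      ‖(1 / 2 : ℝ)‖ₑ ^ (-s) * A.indicator (fun y => ‖y‖ₑ ^ (-r)) y +
      ‖(1 / 2 : ℝ)‖ₑ ^ (-r) * A.indicator (fun y => ‖y‖ₑ ^ (-s)) (y - 1) +
      ‖(1 / 3 : ℝ)‖ₑ ^ (-s) * T.indicator (fun y => ‖y‖ₑ ^ (-(r + s))) y := by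
    intro y
    by_cases h1 : |y| ≤ 1 / 2
    · rw [add_assoc]
      refine le_add_of_le_left ?_
      rw [Set.indicator_of_mem (show y ∈ A from abs_le.1 h1), mul_comm]
      gcongr ?_ * _
      refine ennreal_rpow_le_rpow_of_nonpos (enorm_le_enorm_of_abs_le ?_) (by linarith)
      rw [abs_of_pos (by norm_num : (0:ℝ) < 1 / 2), abs_sub_comm]
      have := abs_le.1 h1
      exact le_trans (by linarith) (le_abs_self _)
    by_cases h2 : |y - 1| ≤ 1 / 2
    · refine le_add_of_le_left (le_add_of_le_right ?_)
      rw [Set.indicator_of_mem (show y - 1 ∈ A from abs_le.1 h2)]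
      gcongr ?_ * _
      refine ennreal_rpow_le_rpow_of_nonpos (enorm_le_enorm_of_abs_le ?_) (by linarith)
      rw [abs_of_pos (by norm_num : (0:ℝ) < 1 / 2)]
      exact (not_le.1 h1).le
    -- Away from `1` one has `|y| ≤ |y - 1| + 1 ≤ 3 |y - 1|`, so the integrand is at most a constant
    -- times `|y|^(-(r+s))`.
    · refine le_add_of_le_right ?_
      have hy : y ≠ 0 := by rintro rfl; norm_num at h1
      rw [Set.indicator_of_mem (show y ∈ T from not_le.1 h1),
        show -(r + s) = -r + -s by ring, enorm_rpow_add hy, mul_left_comm]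
      gcongr _ * ?_
      rw [← ENNReal.mul_rpow_of_ne_top enorm_ne_top enorm_ne_top, ← enorm_mul]
      refine ennreal_rpow_le_rpow_of_nonpos (enorm_le_enorm_of_abs_le ?_) (by linarith)
      rw [abs_mul, abs_of_pos (by norm_num : (0:ℝ) < 1 / 3)]
      have := abs_sub_abs_le_abs_sub y 1
      rw [abs_one] at this
      linarith [not_le.1 h2]
  refine (lintegral_mono hpt).trans_lt ?_
  rw [lintegral_add_right _ (((hm _).indicator hT).const_mul _),
    lintegral_add_left (((hm _).indicator hA).const_mul _),
    lintegral_const_mul _ ((hm _).indicator hA),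
    lintegral_const_mul (‖(1 / 2 : ℝ)‖ₑ ^ (-r))
      (show Measurable fun y : ℝ => A.indicator (fun y : ℝ => ‖y‖ₑ ^ (-s)) (y - 1) from
        ((hm s).indicator hA).comp (measurable_id.sub_const 1)),
    lintegral_const_mul _ ((hm _).indicator hT), lintegral_indicator hA, lintegral_indicator hT]
  refine ENNReal.add_lt_top.2 ⟨ENNReal.add_lt_top.2 ⟨?_, ?_⟩, ?_⟩
  · exact ENNReal.mul_lt_top (hfin _ hhalf).lt_top hI1
  · exact ENNReal.mul_lt_top (hfin _ hhalf).lt_top hI2'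
  · exact ENNReal.mul_lt_top (hfin _ hthird).lt_top hI3

/-- Convolution of two power functions on the line. -/
theorem exists_lintegral_two_singularities_le {r s : ℝ} (hr : r < 1) (hs : s < 1)
    (hrs : 1 < r + s) : ∃ C : ℝ≥0∞, C ≠ ⊤ ∧ ∀ c : ℝ, c ≠ 0 →
      ∫⁻ y : ℝ, ‖y‖ₑ ^ (-r) * ‖y - c‖ₑ ^ (-s) ≤ C * ‖c‖ₑ ^ (1 - r - s) := by
  refine ⟨_, (lintegral_two_singularities_lt_top hr hs hrs).ne, fun c hc => ?_⟩
  have hmeas : Measurable fun y : ℝ => ‖y‖ₑ ^ (-r) * ‖y - c‖ₑ ^ (-s) := by fun_prop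
  -- The substitution `y ↦ c y` moves the second singularity to `1`; homogeneity produces the power
  -- of `c`.
  have h1 : ∫⁻ y : ℝ, ‖y‖ₑ ^ (-r) * ‖y - c‖ₑ ^ (-s) =
      ENNReal.ofReal |c| * ∫⁻ y : ℝ, ‖c * y‖ₑ ^ (-r) * ‖c * y - c‖ₑ ^ (-s) := by
    conv_lhs => rw [← Real.smul_map_volume_mul_left hc]
    rw [lintegral_smul_measure, lintegral_map hmeas (by fun_prop)]
    rfl
  rw [h1]
  have h2 : ∀ y : ℝ, ‖c * y‖ₑ ^ (-r) * ‖c * y - c‖ₑ ^ (-s) =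
      ‖c‖ₑ ^ (-r - s) * (‖y‖ₑ ^ (-r) * ‖y - 1‖ₑ ^ (-s)) := fun y => by
    rw [show c * y - c = c * (y - 1) by ring, enorm_mul, enorm_mul,
      ENNReal.mul_rpow_of_ne_top enorm_ne_top enorm_ne_top,
      ENNReal.mul_rpow_of_ne_top enorm_ne_top enorm_ne_top, sub_eq_add_neg (-r) s, enorm_rpow_add hc]
    ring
  simp_rw [h2]
  rw [lintegral_const_mul _ (by fun_prop), ← mul_assoc, mul_comm]
  gcongr
  rw [show 1 - r - s = 1 + (-r - s) by ring, enorm_rpow_add hc, ENNReal.rpow_one,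
    ← ofReal_norm, Real.norm_eq_abs]

end PowerIntegrals

/-! ### Estimates for the Dirichlet kernel -/

section Dirichlet

/-- The Dirichlet kernel `∑_{t=1}^n e^{i t u}`. -/
def dirichlet (n : ℕ) (u : ℝ) : ℂ :=
  ∑ t ∈ Finset.Icc 1 n, Complex.exp (Complex.I * (t : ℂ) * (u : ℂ))

theorem continuous_dirichlet (n : ℕ) : Continuous (dirichlet n) := by
  unfold dirichlet
  fun_prop

theorem measurable_dirichlet (n : ℕ) : Measurable (dirichlet n) :=
  (continuous_dirichlet n).measurable

theorem norm_exp_I_mul_natCast_mul (t : ℕ) (u : ℝ) :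
    ‖Complex.exp (Complex.I * (t : ℂ) * (u : ℂ))‖ = 1 := by
  have : Complex.I * (t : ℂ) * (u : ℂ) = ((t * u : ℝ) : ℂ) * Complex.I := by push_cast; ring
  rw [this, Complex.norm_exp_ofReal_mul_I]

theorem norm_dirichlet_le (n : ℕ) (u : ℝ) : ‖dirichlet n u‖ ≤ n := by
  refine (norm_sum_le _ _).trans ?_
  simp [norm_exp_I_mul_natCast_mul]

theorem dirichlet_add_two_pi (n : ℕ) (u : ℝ) : dirichlet n (u + 2 * Real.pi) = dirichlet n u := by
  unfold dirichlet
  refine Finset.sum_congr rfl fun t _ => ?_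
  have : Complex.I * (t : ℂ) * ((u + 2 * Real.pi : ℝ) : ℂ) =
      Complex.I * (t : ℂ) * (u : ℂ) + (t : ℕ) * (2 * Real.pi * Complex.I) := by push_cast; ring
  rw [this, Complex.exp_add, Complex.exp_nat_mul_two_pi_mul_I, mul_one]

theorem dirichlet_sub_two_pi (n : ℕ) (u : ℝ) : dirichlet n (u - 2 * Real.pi) = dirichlet n u := by
  rw [← dirichlet_add_two_pi, sub_add_cancel]

/-- The geometric sum gives `|D_n(u)| |e^{iu} - 1| ≤ 2`, and `|e^{iu} - 1| = 2 |sin(u/2)| ≥ 2|u|/π`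
by Jordan's inequality. -/
theorem norm_dirichlet_mul_abs_le (n : ℕ) {u : ℝ} (hu : |u| ≤ Real.pi) :
    ‖dirichlet n u‖ * |u| ≤ Real.pi := by
  set z := Complex.exp (Complex.I * (u : ℂ)) with hz
  have hD : dirichlet n u = z * ∑ t ∈ Finset.range n, z ^ t := by
    unfold dirichlet
    rw [Finset.mul_sum, Finset.range_eq_Ico, ← Finset.Ico_succ_right_eq_Icc,
      Finset.sum_Ico_eq_sum_range, Finset.range_eq_Ico]
    refine Finset.sum_congr (by simp) fun t _ => ?_
    rw [← pow_succ', hz, ← Complex.exp_nat_mul]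
    congr 1
    push_cast
    ring
  have hz1 : ‖z‖ = 1 := by
    have := norm_exp_I_mul_natCast_mul 1 u
    rwa [Nat.cast_one, mul_one] at this
  have h1 : ‖dirichlet n u‖ * ‖z - 1‖ ≤ 2 := by
    rw [hD, norm_mul, hz1, one_mul, ← norm_mul, geom_sum_mul]
    refine (norm_sub_le _ _).trans ?_
    rw [norm_pow, hz1, one_pow, norm_one]
    norm_num
  have h2 : 2 / Real.pi * |u| ≤ ‖z - 1‖ := by
    rw [hz, Complex.norm_exp_I_mul_ofReal_sub_one, Real.norm_eq_abs, abs_mul, abs_two]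
    have h3 : |u / 2| ≤ Real.pi / 2 := by rw [abs_div, abs_two]; linarith
    have h4 := Real.mul_abs_le_abs_sin h3
    rw [abs_div, abs_two] at h4
    calc 2 / Real.pi * |u| = 2 * (2 / Real.pi * (|u| / 2)) := by ring
      _ ≤ _ := by linarith
  have hpi := Real.pi_pos
  have h5 : ‖dirichlet n u‖ * (2 / Real.pi * |u|) ≤ 2 :=
    (mul_le_mul_of_nonneg_left h2 (norm_nonneg _)).trans h1
  have h6 : ‖dirichlet n u‖ * |u| = ‖dirichlet n u‖ * (2 / Real.pi * |u|) * (Real.pi / 2) := by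
    field_simp
  rw [h6]
  calc _ ≤ 2 * (Real.pi / 2) := mul_le_mul_of_nonneg_right h5 (by positivity)
    _ = _ := by ring

/-- Interpolation between the bounds `|D_n| ≤ n` and `|D_n(u)| ≤ π / |u|`. -/
theorem enorm_dirichlet_le_of_abs_le (n : ℕ) {u : ℝ} (hu : |u| ≤ Real.pi) {θ : ℝ} (hθ : 0 ≤ θ)
    (hθ' : θ < 1) :
    ‖dirichlet n u‖ₑ ≤
      ENNReal.ofReal Real.pi ^ (1 - θ) * (n : ℝ≥0∞) ^ θ * ‖u‖ₑ ^ (-(1 - θ)) := by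
  have hn : ‖dirichlet n u‖ₑ ≤ (n : ℝ≥0∞) := by
    rw [← ofReal_norm, ← ENNReal.ofReal_natCast]
    exact ENNReal.ofReal_le_ofReal (norm_dirichlet_le n u)
  have hmul : ‖dirichlet n u‖ₑ * ‖u‖ₑ ≤ ENNReal.ofReal Real.pi := by
    rw [← ofReal_norm, ← ofReal_norm u, ← ENNReal.ofReal_mul (norm_nonneg _)]
    exact ENNReal.ofReal_le_ofReal (norm_dirichlet_mul_abs_le n hu)
  have hpi : ENNReal.ofReal Real.pi ≠ 0 := by simp [Real.pi_pos]
  rcases eq_or_ne u 0 with rfl | hu0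
  · rcases Nat.eq_zero_or_pos n with rfl | hnpos
    · simp [dirichlet]
    -- At `u = 0` the negative power is `⊤`, and its coefficient is nonzero for `n > 0`, so the
    -- bound is trivial.
    · have h0 : ‖(0 : ℝ)‖ₑ ^ (-(1 - θ)) = ⊤ := by
        rw [enorm_zero, ENNReal.zero_rpow_of_neg (by linarith)]
      rw [h0, ENNReal.mul_top]
      · exact le_top
      · refine mul_ne_zero (ENNReal.rpow_pos (pos_iff_ne_zero.2 hpi) (by simp)).ne'
          (ENNReal.rpow_pos (by exact_mod_cast hnpos) (by simp)).ne'
  · have hu1 : ‖u‖ₑ ≠ 0 := enorm_ne_zero.2 hu0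
    have hle : ‖dirichlet n u‖ₑ ≤ ENNReal.ofReal Real.pi * ‖u‖ₑ ^ (-1 : ℝ) := by
      rw [ENNReal.rpow_neg_one, ← div_eq_mul_inv]
      exact (ENNReal.le_div_iff_mul_le (Or.inl hu1) (Or.inl enorm_ne_top)).2 hmul
    calc ‖dirichlet n u‖ₑ = ‖dirichlet n u‖ₑ ^ θ * ‖dirichlet n u‖ₑ ^ (1 - θ) := by
          rw [← ENNReal.rpow_add_of_nonneg _ _ hθ (by linarith), add_sub_cancel, ENNReal.rpow_one]
      _ ≤ (n : ℝ≥0∞) ^ θ * (ENNReal.ofReal Real.pi * ‖u‖ₑ ^ (-1 : ℝ)) ^ (1 - θ) := by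
          have : 0 ≤ 1 - θ := by linarith
          gcongr
      _ = _ := by
          rw [ENNReal.mul_rpow_of_nonneg _ _ (by linarith), ← ENNReal.rpow_mul, neg_one_mul]
          ring

/-- For two frequencies in `(-π, π)` the sum `u = x + y` ranges over `(-2π, 2π)`. Periodicity brings
it back to `[-π, π]`, so the kernel peaks at `0` and at `±2π`. -/
theorem exists_enorm_dirichlet_le (n : ℕ) {u : ℝ} (hu : |u| < 2 * Real.pi) {θ : ℝ} (hθ : 0 ≤ θ)
    (hθ' : θ < 1) : ∃ j ∈ ({0, 2 * Real.pi, -(2 * Real.pi)} : Finset ℝ), ‖dirichlet n u‖ₑ ≤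
      ENNReal.ofReal Real.pi ^ (1 - θ) * (n : ℝ≥0∞) ^ θ * ‖u - j‖ₑ ^ (-(1 - θ)) := by
  have hpi := Real.pi_pos
  obtain ⟨h1, h2⟩ := abs_lt.1 hu
  by_cases h3 : |u| ≤ Real.pi
  · exact ⟨0, by simp, by simpa using enorm_dirichlet_le_of_abs_le n h3 hθ hθ'⟩
  rcases lt_or_ge u 0 with h | h
  · refine ⟨-(2 * Real.pi), by simp, ?_⟩
    rw [abs_of_neg h] at h3
    rw [sub_neg_eq_add, ← dirichlet_add_two_pi]
    exact enorm_dirichlet_le_of_abs_le n (abs_le.2 ⟨by linarith, by linarith⟩) hθ hθ'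
  · refine ⟨2 * Real.pi, by simp, ?_⟩
    rw [abs_of_nonneg h] at h3
    rw [← dirichlet_sub_two_pi]
    exact enorm_dirichlet_le_of_abs_le n (abs_le.2 ⟨by linarith, by linarith⟩) hθ hθ'

theorem enorm_dirichlet_rpow_le (n : ℕ) {u : ℝ} (hu : |u| < 2 * Real.pi) {θ p : ℝ} (hθ : 0 ≤ θ)
    (hθ' : θ < 1) (hp : 0 ≤ p) : ‖dirichlet n u‖ₑ ^ p ≤
      (ENNReal.ofReal Real.pi ^ (1 - θ)) ^ p * (n : ℝ≥0∞) ^ (p * θ) *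
        ∑ j ∈ ({0, 2 * Real.pi, -(2 * Real.pi)} : Finset ℝ), ‖u - j‖ₑ ^ (-(p * (1 - θ))) := by
  obtain ⟨j, hj, h⟩ := exists_enorm_dirichlet_le n hu hθ hθ'
  refine (ENNReal.rpow_le_rpow h hp).trans ?_
  rw [ENNReal.mul_rpow_of_nonneg _ _ hp, ENNReal.mul_rpow_of_nonneg _ _ hp, ← ENNReal.rpow_mul _ θ,
    mul_comm θ, ← ENNReal.rpow_mul _ (-(1 - θ)), show -(1 - θ) * p = -(p * (1 - θ)) by ring]
  gcongr
  exact Finset.single_le_sum (f := fun j => ‖u - j‖ₑ ^ (-(p * (1 - θ)))) (fun _ _ => by simp) hj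

theorem pi_rpow_rpow_ne_top (q p : ℝ) : (ENNReal.ofReal Real.pi ^ q) ^ p ≠ ⊤ := by
  rw [← ENNReal.rpow_mul]
  exact ENNReal.rpow_ne_top_of_ne_zero (by simp [Real.pi_pos]) (by simp)

/-- The interval `(-π, π)` of frequencies. -/
abbrev freq : Set ℝ := Set.Ioo (-Real.pi) Real.pi

theorem abs_add_lt_two_pi {x y : ℝ} (hx : x ∈ freq) (hy : y ∈ freq) : |x + y| < 2 * Real.pi :=
  abs_lt.2 ⟨by linarith [hx.1, hy.1], by linarith [hx.2, hy.2]⟩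

/-- Convolution of a power function with a power of the Dirichlet kernel. -/
theorem exists_lintegral_rpow_mul_dirichlet_le {r θ p : ℝ} (hr : r < 1) (hθ : 0 ≤ θ) (hθ' : θ < 1)
    (hp : 0 ≤ p) (hs : p * (1 - θ) < 1) (hrs : 1 < r + p * (1 - θ)) :
    ∃ C : ℝ≥0∞, C ≠ ⊤ ∧ ∀ (n : ℕ), ∀ x ∈ freq, x ≠ 0 →
      ∫⁻ y in freq, ‖y‖ₑ ^ (-r) * ‖dirichlet n (x + y)‖ₑ ^ p ≤
        C * (n : ℝ≥0∞) ^ (p * θ) * ‖x‖ₑ ^ (1 - r - p * (1 - θ)) := by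
  obtain ⟨C, hC, hb⟩ := exists_lintegral_two_singularities_le hr hs hrs
  set J : Finset ℝ := {0, 2 * Real.pi, -(2 * Real.pi)} with hJ
  set c := (ENNReal.ofReal Real.pi ^ (1 - θ)) ^ p with hc
  refine ⟨c * (J.card * C), ENNReal.mul_ne_top (pi_rpow_rpow_ne_top _ _)
    (ENNReal.mul_ne_top (by simp) hC), fun n x hx hx0 => ?_⟩
  have hpi := Real.pi_pos
  have hj : ∀ j ∈ J, ∫⁻ y : ℝ, ‖y‖ₑ ^ (-r) * ‖x + y - j‖ₑ ^ (-(p * (1 - θ))) ≤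
      C * ‖x‖ₑ ^ (1 - r - p * (1 - θ)) := by
    intro j hj
    -- The peaks at `±2π` are no worse than the one at `0`: `j - x` is at least as far from `0` as
    -- `x`, and the exponent `1 - r - p(1 - θ)` is negative.
    have habs : |x| ≤ |j - x| := by
      simp only [hJ, Finset.mem_insert, Finset.mem_singleton] at hj
      have h1 := abs_lt.2 hx
      rcases hj with rfl | rfl | rfl
      · simp
      · exact h1.le.trans (le_trans (by linarith [hx.2]) (le_abs_self _))
      · exact h1.le.trans (le_trans (by linarith [hx.1]) (neg_le_abs _))
    have hne : j - x ≠ 0 := by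
      have := abs_pos.2 hx0
      exact abs_pos.1 (this.trans_le habs)
    have := hb (j - x) hne
    simp_rw [show ∀ y : ℝ, y - (j - x) = x + y - j from fun y => by ring] at this
    refine this.trans ?_
    gcongr _ * ?_
    exact ennreal_rpow_le_rpow_of_nonpos (enorm_le_enorm_of_abs_le habs) (by linarith)
  calc ∫⁻ y in freq, ‖y‖ₑ ^ (-r) * ‖dirichlet n (x + y)‖ₑ ^ p
      ≤ ∫⁻ y in freq, c * (n : ℝ≥0∞) ^ (p * θ) *
          ∑ j ∈ J, ‖y‖ₑ ^ (-r) * ‖x + y - j‖ₑ ^ (-(p * (1 - θ))) := by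
        refine setLIntegral_mono' measurableSet_Ioo fun y hy => ?_
        rw [← Finset.mul_sum, mul_left_comm]
        gcongr
        exact enorm_dirichlet_rpow_le n (abs_add_lt_two_pi hx hy) hθ hθ' hp
    _ ≤ ∫⁻ y, c * (n : ℝ≥0∞) ^ (p * θ) *
          ∑ j ∈ J, ‖y‖ₑ ^ (-r) * ‖x + y - j‖ₑ ^ (-(p * (1 - θ))) := setLIntegral_le_lintegral _ _
    _ = c * (n : ℝ≥0∞) ^ (p * θ) *
          ∑ j ∈ J, ∫⁻ y, ‖y‖ₑ ^ (-r) * ‖x + y - j‖ₑ ^ (-(p * (1 - θ))) := by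
        rw [lintegral_const_mul _ (by fun_prop), lintegral_finsetSum _ fun j _ => by fun_prop]
    _ ≤ c * (n : ℝ≥0∞) ^ (p * θ) * ∑ j ∈ J, C * ‖x‖ₑ ^ (1 - r - p * (1 - θ)) := by
        gcongr with j hjj
        exact hj j hjj
    _ = _ := by
        rw [Finset.sum_const, nsmul_eq_mul]
        ring

/-- Without a weight, `p(1 - θ) < 1` makes every peak integrable, uniformly in `x`: each translated
window stays inside `[-4π, 4π]`. -/
theorem exists_lintegral_dirichlet_rpow_le {θ p : ℝ} (hθ : 0 ≤ θ) (hθ' : θ < 1)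
    (hp : 0 ≤ p) (hs : p * (1 - θ) < 1) :
    ∃ C : ℝ≥0∞, C ≠ ⊤ ∧ ∀ (n : ℕ), ∀ x ∈ freq,
      ∫⁻ y in freq, ‖dirichlet n (x + y)‖ₑ ^ p ≤ C * (n : ℝ≥0∞) ^ (p * θ) := by
  have hI := lintegral_enorm_rpow_lt_top hs (4 * Real.pi)
  set A := Set.Icc (-(4 * Real.pi)) (4 * Real.pi)
  set C := ∫⁻ y in A, ‖y‖ₑ ^ (-(p * (1 - θ)))
  set J : Finset ℝ := {0, 2 * Real.pi, -(2 * Real.pi)} with hJ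
  set c := (ENNReal.ofReal Real.pi ^ (1 - θ)) ^ p with hc
  refine ⟨c * (J.card * C), ENNReal.mul_ne_top (pi_rpow_rpow_ne_top _ _)
    (ENNReal.mul_ne_top (by simp) hI.ne), fun n x hx => ?_⟩
  have hpi := Real.pi_pos
  have hj : ∀ j ∈ J, ∫⁻ y in freq, ‖x + y - j‖ₑ ^ (-(p * (1 - θ))) ≤ C := by
    intro j hj
    have hmem : ∀ y ∈ freq, y + (x - j) ∈ A := by
      intro y hy
      simp only [hJ, Finset.mem_insert, Finset.mem_singleton] at hj
      rcases hj with rfl | rfl | rfl <;>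
        exact ⟨by linarith [hx.1, hy.1], by linarith [hx.2, hy.2]⟩
    calc ∫⁻ y in freq, ‖x + y - j‖ₑ ^ (-(p * (1 - θ)))
        ≤ ∫⁻ y in freq, A.indicator (fun z => ‖z‖ₑ ^ (-(p * (1 - θ)))) (y + (x - j)) := by
          refine setLIntegral_mono' measurableSet_Ioo fun y hy => ?_
          rw [Set.indicator_of_mem (hmem y hy), show y + (x - j) = x + y - j by ring]
      _ ≤ ∫⁻ y, A.indicator (fun z => ‖z‖ₑ ^ (-(p * (1 - θ)))) (y + (x - j)) :=
          setLIntegral_le_lintegral _ _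
      _ = C := by
          rw [lintegral_add_right_eq_self (A.indicator fun z : ℝ => ‖z‖ₑ ^ (-(p * (1 - θ)))) (x - j),
            lintegral_indicator measurableSet_Icc]
  calc ∫⁻ y in freq, ‖dirichlet n (x + y)‖ₑ ^ p
      ≤ ∫⁻ y in freq, c * (n : ℝ≥0∞) ^ (p * θ) * ∑ j ∈ J, ‖x + y - j‖ₑ ^ (-(p * (1 - θ))) := by
        refine setLIntegral_mono' measurableSet_Ioo fun y hy => ?_
        exact enorm_dirichlet_rpow_le n (abs_add_lt_two_pi hx hy) hθ hθ' hp
    _ = c * (n : ℝ≥0∞) ^ (p * θ) * ∑ j ∈ J, ∫⁻ y in freq, ‖x + y - j‖ₑ ^ (-(p * (1 - θ))) := by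
        rw [lintegral_const_mul _ (by fun_prop), lintegral_finsetSum _ fun j _ => by fun_prop]
    _ ≤ c * (n : ℝ≥0∞) ^ (p * θ) * ∑ j ∈ J, C := by
        gcongr with j hjj
        exact hj j hjj
    _ = _ := by
        rw [Finset.sum_const, nsmul_eq_mul]
        ring

end Dirichlet

/-! ### Integral operators with Dirichlet kernel and power weights -/

section KernelBounds

/-- Cauchy–Schwarz applied to `√p √q`, in a form that lets a product be split without writing square
roots of its factors. -/
theorem sq_lintegral_le_mul_of_sq_le {α : Type*} [MeasurableSpace α] {μ : Measure α}
    {u p q : α → ℝ≥0∞} (hp : AEMeasurable p μ) (hq : AEMeasurable q μ)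
    (h : ∀ᵐ x ∂μ, u x ^ 2 ≤ p x * q x) :
    (∫⁻ x, u x ∂μ) ^ 2 ≤ (∫⁻ x, p x ∂μ) * ∫⁻ x, q x ∂μ := by
  have h1 : ∫⁻ x, u x ∂μ ≤ ∫⁻ x, p x ^ (1 / 2 : ℝ) * q x ^ (1 / 2 : ℝ) ∂μ := by
    refine lintegral_mono_ae ?_
    filter_upwards [h] with x hx
    rw [← ENNReal.mul_rpow_of_nonneg _ _ (by norm_num : (0 : ℝ) ≤ 1 / 2)]
    calc u x = (u x ^ (2 : ℝ)) ^ (1 / 2 : ℝ) := by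
          rw [← ENNReal.rpow_mul]; norm_num
      _ ≤ _ := by
          rw [ENNReal.rpow_two]
          gcongr
  have h2 := ENNReal.lintegral_mul_le_Lp_mul_Lq μ Real.HolderConjugate.two_two
    (hp.pow_const (1 / 2 : ℝ)) (hq.pow_const (1 / 2 : ℝ))
  simp only [Pi.mul_apply, ← ENNReal.rpow_mul] at h2
  norm_num at h2
  have h3 := h1.trans (by norm_num; exact h2)
  calc (∫⁻ x, u x ∂μ) ^ 2
      ≤ ((∫⁻ x, p x ∂μ) ^ (1 / 2 : ℝ) * (∫⁻ x, q x ∂μ) ^ (1 / 2 : ℝ)) ^ 2 := by gcongr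
    _ = _ := by
        rw [mul_pow, ← ENNReal.rpow_natCast, ← ENNReal.rpow_natCast, ← ENNReal.rpow_mul,
          ← ENNReal.rpow_mul]
        norm_num

/-- The integral operator with kernel `D_n(x + y)` is bounded by `n ^ (a + b)` between weighted `L²`
spaces, for weights dominated by `|x| ^ (-a)` and `|y| ^ (-b)` (Schur's test). -/
theorem exists_schur_bound {a b : ℝ} (ha : a < 1) (hb : b < 1) (hab : 0 < a + b)
    {A B : ℝ≥0∞} (hA : A ≠ ⊤) (hB : B ≠ ⊤) {u v : ℝ → ℝ≥0∞}
    (hu : AEMeasurable u (volume.restrict freq))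
    (hua : ∀ᵐ x ∂(volume.restrict freq), u x ≤ A * ‖x‖ₑ ^ (-a))
    (hvb : ∀ᵐ x ∂(volume.restrict freq), v x ≤ B * ‖x‖ₑ ^ (-b)) :
    ∃ C : ℝ≥0∞, C ≠ ⊤ ∧ ∀ (n : ℕ) (φ : ℝ → ℝ≥0∞), Measurable φ →
      ∫⁻ y in freq, v y * (∫⁻ x in freq, u x * φ x * ‖dirichlet n (x + y)‖ₑ) ^ 2 ≤
        C * (n : ℝ≥0∞) ^ (a + b) * ∫⁻ x in freq, u x * φ x ^ 2 := by
  -- `θ` is the interpolation exponent in `|D_n(u)| ≲ n^θ |u|^(-(1-θ))`, and `|x|^(-σ)` is the Schur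
  -- test function. With `2θ = a + b` the powers of `|y|` combine to `-(θ + σ)` and those of `|x|`
  -- cancel. Since `a + σ = (1 + a)/2` and `θ + σ = (1 + b)/2`, the conditions on the two
  -- convolutions reduce to `a, b < 1`.
  set θ := (a + b) / 2 with hθ
  set σ := (1 - a) / 2 with hσ
  obtain ⟨C₁, hC₁, h₁⟩ := exists_lintegral_rpow_mul_dirichlet_le (r := a + σ) (θ := θ) (p := 1)
    (by linarith) (by linarith) (by linarith) (by norm_num) (by linarith) (by linarith)
  obtain ⟨C₂, hC₂, h₂⟩ := exists_lintegral_rpow_mul_dirichlet_le (r := θ + σ) (θ := θ) (p := 1)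
    (by linarith) (by linarith) (by linarith) (by norm_num) (by linarith) (by linarith)
  simp only [ENNReal.rpow_one, one_mul] at h₁ h₂
  refine ⟨A * B * C₁ * C₂, by finiteness, fun n φ hφ => ?_⟩
  have hD := measurable_dirichlet n
  have hmem : ∀ᵐ x ∂(volume.restrict freq), x ∈ freq := ae_restrict_mem measurableSet_Ioo
  have hne := ae_ne_zero_real (volume.restrict freq)
  have hpt : ∀ᵐ y ∂(volume.restrict freq),
      v y * (∫⁻ x in freq, u x * φ x * ‖dirichlet n (x + y)‖ₑ) ^ 2 ≤
        A * B * C₁ * (n : ℝ≥0∞) ^ θ * ∫⁻ x in freq,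
          u x * φ x ^ 2 * ‖x‖ₑ ^ σ * (‖y‖ₑ ^ (-(θ + σ)) * ‖dirichlet n (x + y)‖ₑ) := by
    filter_upwards [hmem, hne, hvb] with y hy hy0 hvy
    have hcs : (∫⁻ x in freq, u x * φ x * ‖dirichlet n (x + y)‖ₑ) ^ 2 ≤
        (∫⁻ x in freq, u x * φ x ^ 2 * ‖x‖ₑ ^ σ * ‖dirichlet n (x + y)‖ₑ) *
          ∫⁻ x in freq, u x * ‖x‖ₑ ^ (-σ) * ‖dirichlet n (x + y)‖ₑ := by
      refine sq_lintegral_le_mul_of_sq_le (by fun_prop) (by fun_prop) ?_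
      filter_upwards [hne] with x hx
      have : ‖x‖ₑ ^ σ * ‖x‖ₑ ^ (-σ) = 1 := by rw [← enorm_rpow_add hx]; simp
      calc (u x * φ x * ‖dirichlet n (x + y)‖ₑ) ^ 2
          = (u x * φ x * ‖dirichlet n (x + y)‖ₑ) ^ 2 * (‖x‖ₑ ^ σ * ‖x‖ₑ ^ (-σ)) := by
            rw [this, mul_one]
        _ ≤ _ := le_of_eq (by ring)
    have hQ : ∫⁻ x in freq, u x * ‖x‖ₑ ^ (-σ) * ‖dirichlet n (x + y)‖ₑ ≤
        A * (C₁ * (n : ℝ≥0∞) ^ θ * ‖y‖ₑ ^ (1 - (a + σ) - (1 - θ))) := by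
      refine le_trans ?_ (mul_le_mul_right (h₁ n y hy hy0) A)
      rw [← lintegral_const_mul' _ _ hA]
      refine lintegral_mono_ae ?_
      filter_upwards [hne, hua] with x hx hux
      rw [neg_add, enorm_rpow_add hx, add_comm y x, ← mul_assoc, ← mul_assoc]
      gcongr
    calc v y * (∫⁻ x in freq, u x * φ x * ‖dirichlet n (x + y)‖ₑ) ^ 2
        ≤ (B * ‖y‖ₑ ^ (-b)) *
          ((∫⁻ x in freq, u x * φ x ^ 2 * ‖x‖ₑ ^ σ * ‖dirichlet n (x + y)‖ₑ) *
            (A * (C₁ * (n : ℝ≥0∞) ^ θ * ‖y‖ₑ ^ (1 - (a + σ) - (1 - θ))))) := by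
          gcongr
          exact hcs.trans (by gcongr)
      _ = A * B * C₁ * (n : ℝ≥0∞) ^ θ * ((‖y‖ₑ ^ (-b) * ‖y‖ₑ ^ (1 - (a + σ) - (1 - θ))) *
            ∫⁻ x in freq, u x * φ x ^ 2 * ‖x‖ₑ ^ σ * ‖dirichlet n (x + y)‖ₑ) := by ring
      _ = A * B * C₁ * (n : ℝ≥0∞) ^ θ * ∫⁻ x in freq,
          u x * φ x ^ 2 * ‖x‖ₑ ^ σ * (‖y‖ₑ ^ (-(θ + σ)) * ‖dirichlet n (x + y)‖ₑ) := by
          rw [← enorm_rpow_add hy0, show -b + (1 - (a + σ) - (1 - θ)) = -(θ + σ) by rw [hθ]; ring,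
            ← lintegral_const_mul' _ _
              (ENNReal.rpow_ne_top_of_ne_zero (enorm_ne_zero.2 hy0) enorm_ne_top)]
          congr 2
          funext x
          ring
  refine (lintegral_mono_ae hpt).trans ?_
  have hnfin : (n : ℝ≥0∞) ^ θ ≠ ⊤ := ENNReal.rpow_ne_top_of_nonneg (by linarith) (by simp)
  rw [lintegral_const_mul' _ _ (by finiteness)]
  have hswap : ∫⁻ y in freq, ∫⁻ x in freq,
      u x * φ x ^ 2 * ‖x‖ₑ ^ σ * (‖y‖ₑ ^ (-(θ + σ)) * ‖dirichlet n (x + y)‖ₑ) =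
      ∫⁻ x in freq, ∫⁻ y in freq,
        u x * φ x ^ 2 * ‖x‖ₑ ^ σ * (‖y‖ₑ ^ (-(θ + σ)) * ‖dirichlet n (x + y)‖ₑ) := by
    refine lintegral_lintegral_swap ?_
    have hu2 : AEMeasurable (fun z : ℝ × ℝ => u z.2)
        ((volume.restrict freq).prod (volume.restrict freq)) :=
      hu.comp_quasiMeasurePreserving Measure.quasiMeasurePreserving_snd
    simp only [Function.uncurry_def]
    fun_prop
  rw [hswap]
  -- Second half of Schur's test: the `y`-integral produces `n^θ |x|^(-σ)`, which cancels the factor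
  -- `|x|^σ` left by Cauchy–Schwarz.
  have hin : ∫⁻ x in freq, ∫⁻ y in freq,
      u x * φ x ^ 2 * ‖x‖ₑ ^ σ * (‖y‖ₑ ^ (-(θ + σ)) * ‖dirichlet n (x + y)‖ₑ) ≤
      ∫⁻ x in freq, C₂ * (n : ℝ≥0∞) ^ θ * (u x * φ x ^ 2) := by
    refine lintegral_mono_ae ?_
    filter_upwards [hmem, hne] with x hx hx0
    rw [lintegral_const_mul _ (by fun_prop)]
    refine (mul_le_mul_right (h₂ n x hx hx0) _).trans (le_of_eq ?_)
    rw [show 1 - (θ + σ) - (1 - θ) = -σ by ring]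
    have : ‖x‖ₑ ^ σ * ‖x‖ₑ ^ (-σ) = 1 := by rw [← enorm_rpow_add hx0]; simp
    calc u x * φ x ^ 2 * ‖x‖ₑ ^ σ * (C₂ * (n : ℝ≥0∞) ^ θ * ‖x‖ₑ ^ (-σ))
        = C₂ * (n : ℝ≥0∞) ^ θ * (u x * φ x ^ 2) * (‖x‖ₑ ^ σ * ‖x‖ₑ ^ (-σ)) := by ring
      _ = _ := by rw [this, mul_one]
  refine (mul_le_mul_right hin _).trans (le_of_eq ?_)
  rw [lintegral_const_mul' _ _ (by finiteness), show a + b = θ + θ by rw [hθ]; ring,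
    ENNReal.rpow_add_of_nonneg _ _ (by linarith) (by linarith)]
  ring

/-- A four-fold cyclic integral of Dirichlet kernels against power weights. -/
theorem exists_cyclic_bound {a b θ : ℝ} (hb : b < 1) (hab : a + b < 1 / 2) (hθ : 1 / 4 < θ)
    (hθ' : θ < 1 / 4 + 3 / 4 * b) (hθ1 : θ < 1) :
    ∃ C : ℝ≥0∞, C ≠ ⊤ ∧ ∀ n : ℕ,
      ∫⁻ y in freq, ∫⁻ w in freq, ‖y‖ₑ ^ (-b) * ‖w‖ₑ ^ (-b) *
        (∫⁻ x in freq, ‖x‖ₑ ^ (-a) * ‖dirichlet n (x + y)‖ₑ * ‖dirichlet n (x + w)‖ₑ) ^ 2 ≤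
        C * (n : ℝ≥0∞) ^ (4 * θ) := by
  -- `s` is the order of the singularity of the bound for `|D_n|^(4/3)`. The condition `θ > 1/4`
  -- means `s < 1`, and `θ < 1/4 + 3b/4` means `b + s > 1`.
  set s := 4 / 3 * (1 - θ) with hs
  obtain ⟨C₁, hC₁, h₁⟩ := exists_lintegral_rpow_mul_dirichlet_le (r := b) (θ := θ) (p := 4 / 3)
    hb (by linarith) hθ1 (by norm_num) (by linarith) (by linarith)
  obtain ⟨C₂, hC₂, h₂⟩ := exists_lintegral_dirichlet_rpow_le (θ := θ) (p := 4 / 3)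
    (by linarith) hθ1 (by norm_num) (by linarith)
  rw [← hs] at h₁
  set E := ∫⁻ x in freq, ‖x‖ₑ ^ (-(2 * a - 2 * (1 - b - s))) with hE
  -- The exponent is `2(a + b) - 2 + 2s`, which is below `1` because `a + b < 1/2` and `s < 1`.
  have hEfin : E ≠ ⊤ := by
    have h := lintegral_enorm_rpow_lt_top (q := 2 * a - 2 * (1 - b - s)) (by linarith) Real.pi
    exact ((lintegral_mono_set Set.Ioo_subset_Icc_self).trans_lt h).ne
  refine ⟨2 * C₂ * C₁ ^ 2 * E, by finiteness, fun n => ?_⟩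
  have hD := measurable_dirichlet n
  have hmem : ∀ᵐ x ∂(volume.restrict freq), x ∈ freq := ae_restrict_mem measurableSet_Ioo
  have hne := ae_ne_zero_real (volume.restrict freq)
  set N := (n : ℝ≥0∞) ^ (4 / 3 * θ) with hN
  have hNfin : N ≠ ⊤ := ENNReal.rpow_ne_top_of_nonneg (by linarith) (by simp)
  -- Each squared kernel is split as `|D|² = |D|^(4/3) |D|^(2/3)`. The two factors `|D|^(2/3)`
  -- integrate to at most a sum of two integrals of `|D|^(4/3)`, hence to `2 C₂ N`.
  have hcs : ∀ y ∈ freq, ∀ w ∈ freq,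
      (∫⁻ x in freq, ‖x‖ₑ ^ (-a) * ‖dirichlet n (x + y)‖ₑ * ‖dirichlet n (x + w)‖ₑ) ^ 2 ≤
        2 * C₂ * N * ∫⁻ x in freq, (‖x‖ₑ ^ (-a)) ^ 2 *
          ‖dirichlet n (x + y)‖ₑ ^ (4 / 3 : ℝ) * ‖dirichlet n (x + w)‖ₑ ^ (4 / 3 : ℝ) := by
    intro y hy w hw
    have h43 : ∀ k : ℝ≥0∞, k ^ 2 = k ^ (4 / 3 : ℝ) * k ^ (2 / 3 : ℝ) := fun k => by
      rw [← ENNReal.rpow_add_of_nonneg _ _ (by norm_num) (by norm_num), ← ENNReal.rpow_natCast]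
      norm_num
    have hsq : ∀ k : ℝ≥0∞, k ^ (2 / 3 : ℝ) * k ^ (2 / 3 : ℝ) = k ^ (4 / 3 : ℝ) := fun k => by
      rw [← ENNReal.rpow_add_of_nonneg _ _ (by norm_num) (by norm_num)]
      norm_num
    have h3 : ∫⁻ x in freq, ‖dirichlet n (x + y)‖ₑ ^ (2 / 3 : ℝ) *
        ‖dirichlet n (x + w)‖ₑ ^ (2 / 3 : ℝ) ≤ 2 * C₂ * N := by
      calc _ ≤ ∫⁻ x in freq, (‖dirichlet n (y + x)‖ₑ ^ (4 / 3 : ℝ) +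
            ‖dirichlet n (w + x)‖ₑ ^ (4 / 3 : ℝ)) := by
            refine lintegral_mono fun x => ?_
            rw [add_comm y, add_comm w]
            rcases le_total (‖dirichlet n (x + y)‖ₑ ^ (2 / 3 : ℝ))
              (‖dirichlet n (x + w)‖ₑ ^ (2 / 3 : ℝ)) with h | h
            · refine le_add_of_le_right ?_
              rw [← hsq (‖dirichlet n (x + w)‖ₑ)]
              gcongr
            · refine le_add_of_le_left ?_
              rw [← hsq (‖dirichlet n (x + y)‖ₑ)]
              gcongr
        _ ≤ C₂ * N + C₂ * N := by
            rw [lintegral_add_left (by fun_prop)]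
            exact add_le_add (h₂ n y hy) (h₂ n w hw)
        _ = _ := by ring
    refine (sq_lintegral_le_mul_of_sq_le
      (p := fun x => (‖x‖ₑ ^ (-a)) ^ 2 * ‖dirichlet n (x + y)‖ₑ ^ (4 / 3 : ℝ) *
        ‖dirichlet n (x + w)‖ₑ ^ (4 / 3 : ℝ))
      (q := fun x => ‖dirichlet n (x + y)‖ₑ ^ (2 / 3 : ℝ) * ‖dirichlet n (x + w)‖ₑ ^ (2 / 3 : ℝ))
      (by fun_prop) (by fun_prop) (ae_of_all _ fun x => le_of_eq ?_)).trans ?_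
    · rw [mul_pow, mul_pow, h43 ‖dirichlet n (x + y)‖ₑ, h43 ‖dirichlet n (x + w)‖ₑ]
      ring
    · rw [mul_comm]
      gcongr
  set J : ℝ → ℝ≥0∞ := fun x => ∫⁻ w in freq, ‖w‖ₑ ^ (-b) * ‖dirichlet n (x + w)‖ₑ ^ (4 / 3 : ℝ)
    with hJ
  have hJm : Measurable J := by
    refine Measurable.lintegral_prod_right' (f := fun z : ℝ × ℝ =>
      ‖z.2‖ₑ ^ (-b) * ‖dirichlet n (z.1 + z.2)‖ₑ ^ (4 / 3 : ℝ)) (by fun_prop)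
  calc ∫⁻ y in freq, ∫⁻ w in freq, ‖y‖ₑ ^ (-b) * ‖w‖ₑ ^ (-b) *
        (∫⁻ x in freq, ‖x‖ₑ ^ (-a) * ‖dirichlet n (x + y)‖ₑ * ‖dirichlet n (x + w)‖ₑ) ^ 2
      ≤ ∫⁻ y in freq, ∫⁻ w in freq, 2 * C₂ * N * ∫⁻ x in freq, (‖y‖ₑ ^ (-b) * (‖x‖ₑ ^ (-a)) ^ 2 *
          ‖dirichlet n (x + y)‖ₑ ^ (4 / 3 : ℝ)) *
            (‖w‖ₑ ^ (-b) * ‖dirichlet n (x + w)‖ₑ ^ (4 / 3 : ℝ)) := by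
        refine setLIntegral_mono' measurableSet_Ioo fun y hy =>
          setLIntegral_mono' measurableSet_Ioo fun w hw => ?_
        refine (mul_le_mul_right (hcs y hy w hw) _).trans (le_of_eq ?_)
        rw [mul_left_comm, ← lintegral_const_mul _ (by fun_prop)]
        congr 2
        funext x
        ring
    _ = ∫⁻ y in freq, 2 * C₂ * N * ∫⁻ x in freq, (‖y‖ₑ ^ (-b) * (‖x‖ₑ ^ (-a)) ^ 2 *
          ‖dirichlet n (x + y)‖ₑ ^ (4 / 3 : ℝ)) * J x := by
        refine lintegral_congr fun y => ?_
        rw [lintegral_const_mul' _ _ (by finiteness), lintegral_lintegral_swap]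
        · congr 2
          funext x
          rw [lintegral_const_mul _ (by fun_prop)]
        · simp only [Function.uncurry_def]
          fun_prop
    -- After the variables `y` and `w` are decoupled, both inner integrals equal `J x`. Each
    -- contributes a factor `N`, so the total is `N³ = n^(4θ)`.
    _ = 2 * C₂ * N * ∫⁻ x in freq, ((‖x‖ₑ ^ (-a)) ^ 2 * J x) * J x := by
        rw [lintegral_const_mul' _ _ (by finiteness), lintegral_lintegral_swap]
        · congr 2
          funext x
          rw [mul_right_comm, ← lintegral_const_mul _ (by fun_prop)]
          refine lintegral_congr fun y => ?_
          ring
        · simp only [Function.uncurry_def]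
          fun_prop
    _ ≤ 2 * C₂ * N * ∫⁻ x in freq, (C₁ * N) ^ 2 * ‖x‖ₑ ^ (-(2 * a - 2 * (1 - b - s))) := by
        refine mul_le_mul_right (lintegral_mono_ae ?_) _
        filter_upwards [hmem, hne] with x hx hx0
        have hJx : J x ≤ C₁ * N * ‖x‖ₑ ^ (1 - b - s) := h₁ n x hx hx0
        calc (‖x‖ₑ ^ (-a)) ^ 2 * J x * J x
            ≤ (‖x‖ₑ ^ (-a)) ^ 2 * (C₁ * N * ‖x‖ₑ ^ (1 - b - s)) * (C₁ * N * ‖x‖ₑ ^ (1 - b - s)) := by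
              gcongr
          _ = (C₁ * N) ^ 2 * (‖x‖ₑ ^ (-a) * ‖x‖ₑ ^ (-a) * (‖x‖ₑ ^ (1 - b - s) * ‖x‖ₑ ^ (1 - b - s))) := by
              ring
          _ = _ := by
              rw [← enorm_rpow_add hx0, ← enorm_rpow_add hx0, ← enorm_rpow_add hx0]
              congr 2
              ring
    _ = 2 * C₂ * C₁ ^ 2 * E * (n : ℝ≥0∞) ^ (4 * θ) := by
        have hN3 : N ^ 3 = (n : ℝ≥0∞) ^ (4 * θ) := by
          rw [hN, ← ENNReal.rpow_natCast, ← ENNReal.rpow_mul]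
          congr 1
          push_cast
          ring
        rw [lintegral_const_mul _ (by fun_prop), ← hN3]
        ring

end KernelBounds

/-! ### Power bounds for regularly varying functions -/

section PowerLaw

theorem ae_comp_mul_left {p : ℝ → Prop} (hp : ∀ᵐ x, p x) {c : ℝ} (hc : c ≠ 0) :
    ∀ᵐ x : ℝ, p (c * x) := by
  have h : Measure.QuasiMeasurePreserving (fun x : ℝ => c * x) volume volume :=
    ⟨by fun_prop, by
      rw [Real.map_volume_mul_left hc]
      exact Measure.smul_absolutelyContinuous⟩
  exact h.ae hp

/-- A function that is regularly varying at `0` with index `-a` and bounded away from `0` is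
dominated by `|x| ^ (-a')` for every `a' > a`. -/
theorem PowerLawAtZero.exists_abs_le {u L : ℝ → ℝ} {a a' : ℝ} (h : PowerLawAtZero u L a)
    (hb : BoundedAwayFromZero u) (ha : a < a') :
    ∃ C : ℝ, 0 ≤ C ∧ ∀ᵐ x ∂(volume.restrict freq), |u x| ≤ C * |x| ^ (-a') := by
  have hpi := Real.pi_pos
  have hlt : (1 : ℝ) < 2 ^ (a' - a) := Real.one_lt_rpow (by norm_num) (by linarith)
  have hev : ∀ᶠ x in 𝓝[≠] (0 : ℝ), |L (1 / 2 * x)| ≤ 2 ^ (a' - a) * |L x| := by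
    have ht := h.slowlyVarying.tendsto_ratio (1 / 2) (by norm_num)
    filter_upwards [ht.eventually (lt_mem_nhds (show (0 : ℝ) < 1 by norm_num)),
      ht.eventually (gt_mem_nhds hlt)] with x h1 h2
    have hL : L x ≠ 0 := by rintro h0; simp [h0] at h1
    rw [← div_le_iff₀ (abs_pos.2 hL), ← abs_div, abs_of_pos h1]
    exact h2.le
  obtain ⟨ρ, hρ, hρL⟩ : ∃ ρ : ℝ, 0 < ρ ∧ ∀ x : ℝ, x ≠ 0 → |x| < ρ →
      |L (1 / 2 * x)| ≤ 2 ^ (a' - a) * |L x| := by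
    obtain ⟨ρ, hρ, hs⟩ := Metric.mem_nhdsWithin_iff.1 hev
    exact ⟨ρ, hρ, fun x hx hxρ => hs ⟨by simpa using hxρ, hx⟩⟩
  set x₀ := min ρ Real.pi with hx₀
  have hx₀pos : 0 < x₀ := lt_min hρ hpi
  -- Slow variation at ratio `1/2` loses at most a factor `2^(a' - a)`, which is exactly what the
  -- larger weight `|x|^a'` gains under doubling.
  have hdouble : ∀ x : ℝ, x ≠ 0 → |x| < x₀ / 2 → |u x| * |x| ^ a' ≤ |u (2 * x)| * |2 * x| ^ a' := by
    intro x hx hxx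
    have h2x : |2 * x| < x₀ := by rw [abs_mul, abs_two]; linarith
    have hxpos := abs_pos.2 hx
    have hmem : x ∈ freq := abs_lt.1 (hxx.trans (by linarith [min_le_right ρ Real.pi]))
    have hmem2 : 2 * x ∈ freq := abs_lt.1 (h2x.trans_le (min_le_right _ _))
    have hL := hρL (2 * x) (by simpa using hx) (h2x.trans_le (min_le_left _ _))
    rw [show 1 / 2 * (2 * x) = x by ring] at hL
    rw [h.eq_rpow_mul x hmem hx, h.eq_rpow_mul (2 * x) hmem2 (by simpa using hx), abs_mul, abs_mul,
      abs_of_nonneg (Real.rpow_nonneg (abs_nonneg x) _),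
      abs_of_nonneg (Real.rpow_nonneg (abs_nonneg (2 * x)) _), abs_mul, abs_two,
      Real.mul_rpow (by norm_num) hxpos.le, Real.mul_rpow (by norm_num) hxpos.le]
    calc |x| ^ (-a) * |L x| * |x| ^ a' ≤ |x| ^ (-a) * (2 ^ (a' - a) * |L (2 * x)|) * |x| ^ a' := by
          gcongr
      _ = _ := by
          rw [sub_eq_add_neg, Real.rpow_add (by norm_num)]
          ring
  obtain ⟨M, hM⟩ := hb (x₀ / 2) (by linarith)
  -- The sign of `a'` is not prescribed, so `|x|^a'` is bounded by its larger value at the endpoints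
  -- of `[x₀/2, π]`.
  set C := max M 0 * max (Real.pi ^ a') ((x₀ / 2) ^ a') with hC
  have hfar : ∀ x ∈ freq, x₀ / 2 ≤ |x| → |u x| ≤ M → |u x| * |x| ^ a' ≤ C := by
    intro x hx hxx hux
    have hlow : 0 < x₀ / 2 := by linarith
    refine mul_le_mul (hux.trans (le_max_left _ _)) ?_ (by positivity) (le_max_right _ _)
    · rcases le_total 0 a' with h0 | h0
      · exact le_max_of_le_left (Real.rpow_le_rpow (abs_nonneg _) (abs_lt.2 hx).le h0)
      · exact le_max_of_le_right (Real.rpow_le_rpow_of_nonpos hlow hxx h0)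
  -- The bound `M` holds only almost everywhere, but the iteration evaluates `u` along the orbit
  -- `2^k x`; countably many rescaled null sets are discarded at once.
  have hgood : ∀ᵐ x : ℝ, ∀ k : ℕ, 2 ^ k * x ∈ freq → x₀ / 2 ≤ |2 ^ k * x| → |u (2 ^ k * x)| ≤ M := by
    rw [ae_all_iff]
    intro k
    exact ae_comp_mul_left ((ae_restrict_iff' measurableSet_Ioo).1 hM) (by positivity)
  -- Doubling is repeated until `|x| ≥ x₀/2`; `k` bounds the number of doublings needed.
  have hind : ∀ k : ℕ, ∀ x : ℝ, x ≠ 0 → x ∈ freq → x₀ ≤ 2 ^ (k + 1) * |x| →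
      (∀ k : ℕ, 2 ^ k * x ∈ freq → x₀ / 2 ≤ |2 ^ k * x| → |u (2 ^ k * x)| ≤ M) →
      |u x| * |x| ^ a' ≤ C := by
    intro k
    induction k with
    | zero =>
      intro x _ hx hxx hg
      have hxx' : x₀ / 2 ≤ |x| := by rw [zero_add, pow_one] at hxx; linarith
      exact hfar x hx hxx' (by simpa using hg 0 (by simpa using hx) (by simpa using hxx'))
    | succ k ih =>
      intro x hx0 hx hxx hg
      rcases le_or_gt (x₀ / 2) |x| with hc | hc
      · exact hfar x hx hc (by simpa using hg 0 (by simpa using hx) (by simpa using hc))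
      · refine (hdouble x hx0 hc).trans (ih (2 * x) (by simpa using hx0) ?_ ?_ fun j => ?_)
        · have h2x : |2 * x| < x₀ := by rw [abs_mul, abs_two]; linarith
          exact abs_lt.1 (h2x.trans_le (min_le_right _ _))
        · rw [abs_mul, abs_two]
          calc x₀ ≤ 2 ^ (k + 1 + 1) * |x| := hxx
            _ = _ := by ring
        · have := hg (j + 1)
          rwa [pow_succ, mul_assoc] at this
  refine ⟨C, by positivity, ?_⟩
  rw [ae_restrict_iff' measurableSet_Ioo]
  filter_upwards [hgood, ae_ne_zero_real volume] with x hg hx0 hx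
  have hxpos := abs_pos.2 hx0
  obtain ⟨k, hk⟩ := pow_unbounded_of_one_lt (x₀ / |x|) (show (1 : ℝ) < 2 by norm_num)
  have hk' : x₀ ≤ 2 ^ (k + 1) * |x| := by
    rw [div_lt_iff₀ hxpos] at hk
    rw [pow_succ]
    nlinarith [mul_pos (pow_pos (show (0 : ℝ) < 2 by norm_num) k) hxpos]
  have := hind k x hx0 hx hk' hg
  rw [Real.rpow_neg hxpos.le, ← div_eq_mul_inv, le_div_iff₀ (Real.rpow_pos_of_pos hxpos _)]
  exact this

theorem PowerLawAtZero.exists_enorm_le {u L : ℝ → ℝ} {a a' : ℝ} (h : PowerLawAtZero u L a)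
    (hb : BoundedAwayFromZero u) (ha : a < a') :
    ∃ C : ℝ≥0∞, C ≠ ⊤ ∧ ∀ᵐ x ∂(volume.restrict freq), ‖u x‖ₑ ≤ C * ‖x‖ₑ ^ (-a') := by
  obtain ⟨C, hC, hle⟩ := h.exists_abs_le hb ha
  refine ⟨ENNReal.ofReal C, by simp, ?_⟩
  filter_upwards [hle, ae_ne_zero_real (volume.restrict freq)] with x hx hx0
  rw [enorm_rpow_eq_ofReal hx0, ← ENNReal.ofReal_mul hC, ← ofReal_norm]
  exact ENNReal.ofReal_le_ofReal hx

end PowerLaw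

/-! ### Finite sums of Fourier coefficients -/

section Fourier

/-- The character `x ↦ e^{i k x}`. -/
def expI (k : ℤ) (x : ℝ) : ℂ := Complex.exp (Complex.I * (k : ℂ) * (x : ℂ))

theorem continuous_expI (k : ℤ) : Continuous (expI k) := by
  unfold expI
  fun_prop

theorem measurable_expI (k : ℤ) : Measurable (expI k) := (continuous_expI k).measurable

theorem expI_add (k l : ℤ) (x : ℝ) : expI (k + l) x = expI k x * expI l x := by
  simp only [expI, ← Complex.exp_add]
  congr 1
  push_cast
  ring

theorem expI_add_right (k : ℤ) (x y : ℝ) : expI k (x + y) = expI k x * expI k y := by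
  simp only [expI, ← Complex.exp_add]
  congr 1
  push_cast
  ring

theorem expI_neg (k : ℤ) (x : ℝ) : expI (-k) x = starRingEnd ℂ (expI k x) := by
  simp [expI, ← Complex.exp_conj]

theorem expI_sub (k l : ℤ) (x : ℝ) : expI (k - l) x = expI k x * starRingEnd ℂ (expI l x) := by
  rw [sub_eq_add_neg, expI_add, expI_neg]

theorem norm_expI (k : ℤ) (x : ℝ) : ‖expI k x‖ = 1 := by
  have : Complex.I * (k : ℂ) * (x : ℂ) = ((k * x : ℝ) : ℂ) * Complex.I := by push_cast; ring
  rw [expI, this, Complex.norm_exp_ofReal_mul_I]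

theorem dirichlet_eq_sum_expI (n : ℕ) (x : ℝ) :
    dirichlet n x = ∑ t ∈ Finset.Icc 1 n, expI (t : ℤ) x := by
  simp [dirichlet, expI]

/-- The Fourier integral `∫_{-π}^{π} e^{i k x} u(x) dx`. -/
def fourierInt (u : ℝ → ℝ) (k : ℤ) : ℂ := ∫ x in freq, expI k x * (u x : ℂ)

theorem intervalIntegral_eq_setIntegral_freq (F : ℝ → ℂ) :
    ∫ x in (-Real.pi)..Real.pi, F x = ∫ x in freq, F x := by
  rw [intervalIntegral.integral_of_le (by linarith [Real.pi_pos]), integral_Ioc_eq_integral_Ioo]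

theorem fourierCoeffOf_eq (u : ℝ → ℝ) (k : ℤ) :
    fourierCoeffOf u k = (1 / (2 * Real.pi) : ℂ) * fourierInt u k := by
  simp only [fourierCoeffOf, fourierInt, intervalIntegral_eq_setIntegral_freq, expI, mul_comm]

theorem integrable_expI_mul {u : ℝ → ℝ} (hu : IntegrableOn u freq) (k : ℤ) :
    Integrable (fun x => expI k x * (u x : ℂ)) (volume.restrict freq) :=
  hu.ofReal.bdd_mul (c := 1) (measurable_expI k).aestronglyMeasurable
    (ae_of_all _ fun x => (norm_expI k x).le)

theorem fourierInt_neg (u : ℝ → ℝ) (k : ℤ) :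
    fourierInt u (-k) = starRingEnd ℂ (fourierInt u k) := by
  unfold fourierInt
  rw [← integral_conj]
  simp [expI_neg]

theorem sum_mul_fourierInt {u : ℝ → ℝ} (hu : IntegrableOn u freq) {ι : Type*} (s : Finset ι)
    (c : ι → ℂ) (k : ι → ℤ) :
    ∑ i ∈ s, c i * fourierInt u (k i) = ∫ x in freq, (u x : ℂ) * ∑ i ∈ s, c i * expI (k i) x := by
  unfold fourierInt
  simp_rw [← integral_const_mul]
  rw [← integral_finsetSum _ fun i _ => (integrable_expI_mul hu (k i)).const_mul (c i)]
  refine integral_congr_ae (ae_of_all _ fun x => ?_)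
  simp only [Finset.mul_sum]
  refine Finset.sum_congr rfl fun i _ => ?_
  ring

theorem enorm_sum_mul_fourierInt_le {u : ℝ → ℝ} (hu : IntegrableOn u freq) {ι : Type*}
    (s : Finset ι) (c : ι → ℂ) (k : ι → ℤ) :
    ‖∑ i ∈ s, c i * fourierInt u (k i)‖ₑ ≤
      ∫⁻ x in freq, ‖u x‖ₑ * ‖∑ i ∈ s, c i * expI (k i) x‖ₑ := by
  rw [sum_mul_fourierInt hu]
  refine (enorm_integral_le_lintegral_enorm _).trans (le_of_eq ?_)
  refine lintegral_congr fun x => ?_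
  rw [enorm_mul]
  congr 1
  rw [← ofReal_norm, ← ofReal_norm, Complex.norm_real]

theorem sum_product_mul {ι κ : Type*} (s : Finset ι) (t : Finset κ) (a : ι → ℂ) (b : κ → ℂ) :
    ∑ p ∈ s ×ˢ t, a p.1 * b p.2 = (∑ i ∈ s, a i) * ∑ j ∈ t, b j := by
  rw [Finset.sum_product, Finset.sum_mul_sum]

theorem enorm_conj (z : ℂ) : ‖starRingEnd ℂ z‖ₑ = ‖z‖ₑ := by
  rw [← ofReal_norm, ← ofReal_norm, RCLike.norm_conj]

/-- A cyclic sum of four Fourier integrals, bounded by a cyclic integral of Dirichlet kernels. -/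
theorem enorm_cyclic_sum_le {u v : ℝ → ℝ} (hu : IntegrableOn u freq) (hv : IntegrableOn v freq)
    {U V : ℤ → ℝ} (hU : ∀ k, (U k : ℂ) = fourierInt u k) (hV : ∀ k, (V k : ℂ) = fourierInt v k)
    (n : ℕ) :
    ‖∑ p ∈ Finset.Icc 1 n ×ˢ Finset.Icc 1 n, ∑ q ∈ Finset.Icc 1 n ×ˢ Finset.Icc 1 n,
      U ((p.1 : ℤ) - p.2) * U ((q.1 : ℤ) - q.2) * (V ((p.1 : ℤ) - q.1) * V ((p.2 : ℤ) - q.2))‖ₑ ≤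
      ∫⁻ y in freq, ∫⁻ w in freq, ‖u y‖ₑ * ‖u w‖ₑ *
        (∫⁻ x in freq, ‖v x‖ₑ * ‖dirichlet n (x + y)‖ₑ * ‖dirichlet n (x + w)‖ₑ) ^ 2 := by
  set T := Finset.Icc 1 n with hT
  -- Real Fourier coefficients are even, since `fourierInt` is conjugated by `k ↦ -k`. This supplies
  -- the sign change that makes the integrand below `R * conj R`.
  have hUneg : ∀ k, U (-k) = U k := fun k => by
    have h : (U (-k) : ℂ) = (U k : ℂ) := by
      rw [hU, fourierInt_neg, ← hU, Complex.conj_ofReal]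
    exact_mod_cast h
  let R : ℝ → ℝ → ℂ := fun y w => ∑ p ∈ T ×ˢ T,
    (V ((p.1 : ℤ) - p.2) : ℂ) * (expI p.1 y * starRingEnd ℂ (expI p.2 w))
  have hR : ∀ y w, ‖R y w‖ₑ ≤
      ∫⁻ x in freq, ‖v x‖ₑ * ‖dirichlet n (x + y)‖ₑ * ‖dirichlet n (x + w)‖ₑ := by
    intro y w
    have h1 := enorm_sum_mul_fourierInt_le hv (T ×ˢ T)
      (fun p => expI p.1 y * starRingEnd ℂ (expI p.2 w)) (fun p => (p.1 : ℤ) - p.2)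
    have h2 : R y w = ∑ p ∈ T ×ˢ T,
        expI p.1 y * starRingEnd ℂ (expI p.2 w) * fourierInt v ((p.1 : ℤ) - p.2) :=
      Finset.sum_congr rfl fun p _ => by rw [← hV, mul_comm]
    rw [h2]
    refine h1.trans (le_of_eq (lintegral_congr fun x => ?_))
    have h3 : ∑ p ∈ T ×ˢ T, expI p.1 y * starRingEnd ℂ (expI p.2 w) * expI ((p.1 : ℤ) - p.2) x =
        dirichlet n (x + y) * starRingEnd ℂ (dirichlet n (x + w)) := by
      rw [dirichlet_eq_sum_expI, dirichlet_eq_sum_expI, map_sum, ← sum_product_mul]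
      refine Finset.sum_congr rfl fun p _ => ?_
      rw [expI_sub, expI_add_right, expI_add_right, map_mul]
      ring
    rw [h3, enorm_mul, enorm_conj, mul_assoc]
  have hstep : ∀ y, ‖∑ p ∈ T ×ˢ T, (∑ q ∈ T ×ˢ T, (U ((q.1 : ℤ) - q.2) : ℂ) *
      (V ((p.1 : ℤ) - q.1) * V ((p.2 : ℤ) - q.2))) * expI ((p.1 : ℤ) - p.2) y‖ₑ ≤
      ∫⁻ w in freq, ‖u w‖ₑ * ‖R y w‖ₑ ^ 2 := by
    intro y
    have h1 := enorm_sum_mul_fourierInt_le hu (T ×ˢ T)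
      (fun q => ∑ p ∈ T ×ˢ T, (V ((p.1 : ℤ) - q.1) * V ((p.2 : ℤ) - q.2) : ℂ) *
        expI ((p.1 : ℤ) - p.2) y) (fun q => -((q.1 : ℤ) - q.2))
    have h2 : ∑ p ∈ T ×ˢ T, (∑ q ∈ T ×ˢ T, (U ((q.1 : ℤ) - q.2) : ℂ) *
        (V ((p.1 : ℤ) - q.1) * V ((p.2 : ℤ) - q.2))) * expI ((p.1 : ℤ) - p.2) y =
        ∑ q ∈ T ×ˢ T, (∑ p ∈ T ×ˢ T, (V ((p.1 : ℤ) - q.1) * V ((p.2 : ℤ) - q.2) : ℂ) *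
        expI ((p.1 : ℤ) - p.2) y) * fourierInt u (-((q.1 : ℤ) - q.2)) := by
      simp_rw [Finset.sum_mul]
      rw [Finset.sum_comm]
      refine Finset.sum_congr rfl fun q _ => Finset.sum_congr rfl fun p _ => ?_
      rw [← hU, hUneg]
      ring
    rw [h2]
    refine h1.trans (le_of_eq (lintegral_congr fun w => ?_))
    have h3 : ∑ q ∈ T ×ˢ T, (∑ p ∈ T ×ˢ T, (V ((p.1 : ℤ) - q.1) * V ((p.2 : ℤ) - q.2) : ℂ) *
        expI ((p.1 : ℤ) - p.2) y) * expI (-((q.1 : ℤ) - q.2)) w = R y w * starRingEnd ℂ (R y w) := by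
      simp only [R, map_sum]
      rw [← sum_product_mul]
      simp_rw [Finset.sum_mul]
      rw [← Finset.sum_product']
      -- The four indices are regrouped as `(p₁, q₁)` and `(p₂, q₂)`, the pairs linked by `V`; each
      -- pair sums to `R` or to its conjugate.
      refine Finset.sum_nbij' (fun z => ((z.2.1, z.1.1), (z.2.2, z.1.2)))
        (fun r => ((r.1.2, r.2.2), (r.1.1, r.2.1))) (fun z hz => ?_) (fun z hz => ?_)
        (fun _ _ => rfl) (fun _ _ => rfl) fun z _ => ?_
      · simp only [Finset.mem_product] at hz ⊢; tauto
      · simp only [Finset.mem_product] at hz ⊢; tauto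
      · simp only [expI_sub, expI_neg, map_mul, Complex.conj_conj, Complex.conj_ofReal]
        ring
    rw [h3, enorm_mul, enorm_conj, sq]
  have hS : ((∑ p ∈ T ×ˢ T, ∑ q ∈ T ×ˢ T,
      U ((p.1 : ℤ) - p.2) * U ((q.1 : ℤ) - q.2) * (V ((p.1 : ℤ) - q.1) * V ((p.2 : ℤ) - q.2)) : ℝ) : ℂ) =
      ∑ p ∈ T ×ˢ T, (∑ q ∈ T ×ˢ T, (U ((q.1 : ℤ) - q.2) : ℂ) *
        (V ((p.1 : ℤ) - q.1) * V ((p.2 : ℤ) - q.2))) * fourierInt u ((p.1 : ℤ) - p.2) := by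
    push_cast
    refine Finset.sum_congr rfl fun p _ => ?_
    rw [Finset.sum_mul]
    refine Finset.sum_congr rfl fun q _ => ?_
    rw [← hU]
    ring
  have hSn : ∀ z : ℝ, ‖z‖ₑ = ‖(z : ℂ)‖ₑ := fun z => by
    rw [← ofReal_norm, ← ofReal_norm, Complex.norm_real]
  rw [hSn, hS]
  refine (enorm_sum_mul_fourierInt_le hu _ _ _).trans (lintegral_mono fun y => ?_)
  rw [show (∫⁻ w in freq, ‖u y‖ₑ * ‖u w‖ₑ *
        (∫⁻ x in freq, ‖v x‖ₑ * ‖dirichlet n (x + y)‖ₑ * ‖dirichlet n (x + w)‖ₑ) ^ 2) =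
        ‖u y‖ₑ * ∫⁻ w in freq, ‖u w‖ₑ *
        (∫⁻ x in freq, ‖v x‖ₑ * ‖dirichlet n (x + y)‖ₑ * ‖dirichlet n (x + w)‖ₑ) ^ 2 by
      rw [← lintegral_const_mul' _ _ enorm_ne_top]
      simp_rw [mul_assoc]]
  gcongr
  refine (hstep y).trans (lintegral_mono fun w => ?_)
  gcongr
  exact hR y w

end Fourier

/-! ### Toeplitz forms of stationary sequences -/

section Toeplitz

variable {H : Type*} [NormedAddCommGroup H] [InnerProductSpace ℝ H]

theorem EvenAE.conj_fourierInt {u : ℝ → ℝ} (hu : EvenAE u) (k : ℤ) :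
    starRingEnd ℂ (fourierInt u k) = fourierInt u k := by
  rw [← fourierInt_neg]
  unfold fourierInt
  rw [← intervalIntegral_eq_setIntegral_freq, ← intervalIntegral_eq_setIntegral_freq]
  have h1 := intervalIntegral.integral_comp_neg (a := -Real.pi) (b := Real.pi)
    fun x => expI k x * (u x : ℂ)
  rw [neg_neg] at h1
  rw [← h1, intervalIntegral_eq_setIntegral_freq, intervalIntegral_eq_setIntegral_freq]
  refine integral_congr_ae ?_
  filter_upwards [hu] with x hx
  rw [hx]
  simp [expI]

theorem EvenAE.ofReal_re_fourierInt {u : ℝ → ℝ} (hu : EvenAE u) (k : ℤ) :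
    ((fourierInt u k).re : ℂ) = fourierInt u k :=
  Complex.conj_eq_iff_re.1 (hu.conj_fourierInt k)

variable {h : ℤ → H} {f g : ℝ → ℝ} {A G : ℤ → ℝ}

theorem inner_sum_sum_tmul (hA : ∀ t s, ⟪h t, h s⟫_ℝ = A (t - s)) (G : ℤ → ℝ) (n : ℕ) :
    ‖∑ p ∈ Finset.Icc 1 n ×ˢ Finset.Icc 1 n,
      G ((p.1 : ℤ) - p.2) • (h (p.1 : ℤ) ⊗ₜ[ℝ] h (p.2 : ℤ))‖ ^ 2 =
      ∑ p ∈ Finset.Icc 1 n ×ˢ Finset.Icc 1 n, ∑ q ∈ Finset.Icc 1 n ×ˢ Finset.Icc 1 n,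
      G ((p.1 : ℤ) - p.2) * G ((q.1 : ℤ) - q.2) * (A ((p.1 : ℤ) - q.1) * A ((p.2 : ℤ) - q.2)) := by
  rw [← real_inner_self_eq_norm_sq, sum_inner]
  refine Finset.sum_congr rfl fun p _ => ?_
  rw [inner_sum]
  refine Finset.sum_congr rfl fun q _ => ?_
  rw [tensor_inner_smul_left, tensor_inner_smul_right, TensorProduct.inner_tmul, hA, hA]
  ring

/-- Exchanging `p₂` and `q₁` rotates the four-cycle and swaps the roles of `A` and `G`. This allows
either density to be the outer weight in the cyclic estimate. -/
theorem cyclic_sum_symm (A G : ℤ → ℝ) (n : ℕ) :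
    ∑ p ∈ Finset.Icc 1 n ×ˢ Finset.Icc 1 n, ∑ q ∈ Finset.Icc 1 n ×ˢ Finset.Icc 1 n,
      G ((p.1 : ℤ) - p.2) * G ((q.1 : ℤ) - q.2) * (A ((p.1 : ℤ) - q.1) * A ((p.2 : ℤ) - q.2)) =
    ∑ p ∈ Finset.Icc 1 n ×ˢ Finset.Icc 1 n, ∑ q ∈ Finset.Icc 1 n ×ˢ Finset.Icc 1 n,
      A ((p.1 : ℤ) - p.2) * A ((q.1 : ℤ) - q.2) * (G ((p.1 : ℤ) - q.1) * G ((p.2 : ℤ) - q.2)) := by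
  rw [← Finset.sum_product', ← Finset.sum_product']
  refine Finset.sum_nbij' (fun z => ((z.1.1, z.2.1), (z.1.2, z.2.2)))
    (fun z => ((z.1.1, z.2.1), (z.1.2, z.2.2))) (fun z hz => ?_) (fun z hz => ?_)
    (fun _ _ => rfl) (fun _ _ => rfl) fun z _ => ?_
  · simp only [Finset.mem_product] at hz ⊢; tauto
  · simp only [Finset.mem_product] at hz ⊢; tauto
  · ring

/-- The Hilbert–Schmidt norm of the kernel. -/
theorem exists_cyclic_sum_bound {u v : ℝ → ℝ} {U V : ℤ → ℝ}
    (hu : IntegrableOn u freq) (hv : IntegrableOn v freq)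
    (hU : ∀ k, (U k : ℂ) = fourierInt u k) (hV : ∀ k, (V k : ℂ) = fourierInt v k)
    {a b θ : ℝ} {B₁ B₂ : ℝ≥0∞} (hB₁ : B₁ ≠ ⊤) (hB₂ : B₂ ≠ ⊤)
    (hub : ∀ᵐ x ∂(volume.restrict freq), ‖u x‖ₑ ≤ B₁ * ‖x‖ₑ ^ (-b))
    (hva : ∀ᵐ x ∂(volume.restrict freq), ‖v x‖ₑ ≤ B₂ * ‖x‖ₑ ^ (-a))
    (hb : b < 1) (hab : a + b < 1 / 2) (hθ : 1 / 4 < θ)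
    (hθ' : θ < 1 / 4 + 3 / 4 * b) (hθ1 : θ < 1) :
    ∃ C : ℝ, ∀ n : ℕ, |∑ p ∈ Finset.Icc 1 n ×ˢ Finset.Icc 1 n,
      ∑ q ∈ Finset.Icc 1 n ×ˢ Finset.Icc 1 n, U ((p.1 : ℤ) - p.2) * U ((q.1 : ℤ) - q.2) *
        (V ((p.1 : ℤ) - q.1) * V ((p.2 : ℤ) - q.2))| ≤ C * (n : ℝ) ^ (4 * θ) := by
  obtain ⟨C, hC, hb⟩ := exists_cyclic_bound (a := a) hb hab hθ hθ' hθ1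
  refine ⟨(B₁ * B₁ * B₂ ^ 2 * C).toReal, fun n => ?_⟩
  have h1 : ∫⁻ y in freq, ∫⁻ w in freq, ‖u y‖ₑ * ‖u w‖ₑ *
        (∫⁻ x in freq, ‖v x‖ₑ * ‖dirichlet n (x + y)‖ₑ * ‖dirichlet n (x + w)‖ₑ) ^ 2 ≤
      B₁ * B₁ * B₂ ^ 2 * C * (n : ℝ≥0∞) ^ (4 * θ) := by
    have hQ : ∀ y w, ∫⁻ x in freq, ‖v x‖ₑ * ‖dirichlet n (x + y)‖ₑ * ‖dirichlet n (x + w)‖ₑ ≤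
        B₂ * ∫⁻ x in freq, ‖x‖ₑ ^ (-a) * ‖dirichlet n (x + y)‖ₑ * ‖dirichlet n (x + w)‖ₑ := by
      intro y w
      rw [← lintegral_const_mul' _ _ hB₂]
      refine lintegral_mono_ae ?_
      filter_upwards [hva] with x hx
      rw [← mul_assoc, ← mul_assoc]
      gcongr
    calc _ ≤ ∫⁻ y in freq, ∫⁻ w in freq, B₁ * B₁ * B₂ ^ 2 * (‖y‖ₑ ^ (-b) * ‖w‖ₑ ^ (-b) *
        (∫⁻ x in freq, ‖x‖ₑ ^ (-a) * ‖dirichlet n (x + y)‖ₑ * ‖dirichlet n (x + w)‖ₑ) ^ 2) := by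
          refine lintegral_mono_ae ?_
          filter_upwards [hub] with y hy
          refine lintegral_mono_ae ?_
          filter_upwards [hub] with w hw
          calc _ ≤ (B₁ * ‖y‖ₑ ^ (-b)) * (B₁ * ‖w‖ₑ ^ (-b)) * (B₂ * ∫⁻ x in freq,
                ‖x‖ₑ ^ (-a) * ‖dirichlet n (x + y)‖ₑ * ‖dirichlet n (x + w)‖ₑ) ^ 2 := by
                gcongr
                exact hQ y w
            _ = _ := by ring
      _ = B₁ * B₁ * B₂ ^ 2 * ∫⁻ y in freq, ∫⁻ w in freq, ‖y‖ₑ ^ (-b) * ‖w‖ₑ ^ (-b) *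
        (∫⁻ x in freq, ‖x‖ₑ ^ (-a) * ‖dirichlet n (x + y)‖ₑ * ‖dirichlet n (x + w)‖ₑ) ^ 2 := by
          rw [← lintegral_const_mul' _ _ (by finiteness)]
          refine lintegral_congr fun y => ?_
          rw [lintegral_const_mul' _ _ (by finiteness)]
      _ ≤ B₁ * B₁ * B₂ ^ 2 * (C * (n : ℝ≥0∞) ^ (4 * θ)) := by gcongr; exact hb n
      _ = _ := by ring
  have h2 := (enorm_cyclic_sum_le hu hv hU hV n).trans h1
  have hn : (n : ℝ≥0∞) ^ (4 * θ) ≠ ⊤ := ENNReal.rpow_ne_top_of_nonneg (by linarith) (by simp)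
  have h3 := ENNReal.toReal_mono (by finiteness) h2
  rw [toReal_enorm, Real.norm_eq_abs] at h3
  refine h3.trans (le_of_eq ?_)
  rw [ENNReal.toReal_mul, ← ENNReal.toReal_rpow]
  simp

/-- The spectral isometry: sending `h s` to the conjugate character carries the span of the sequence
into `L²(f)`. Nonnegativity of `f` makes the weight a measure. -/
theorem lintegral_enorm_mul_sq_eq_norm_sq (hf : IntegrableOn f freq)
    (hf0 : ∀ᵐ x ∂(volume.restrict freq), 0 ≤ f x)
    (hA : ∀ t s, ⟪h t, h s⟫_ℝ = A (t - s)) (hA' : ∀ k, (A k : ℂ) = fourierInt f k)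
    (T : Finset ℕ) (c : ℕ → ℝ) :
    ∫⁻ x in freq, ‖f x‖ₑ * ‖∑ s ∈ T, (c s : ℂ) * starRingEnd ℂ (expI s x)‖ₑ ^ 2 =
      ENNReal.ofReal (‖∑ s ∈ T, c s • h (s : ℤ)‖ ^ 2) := by
  set φ : ℝ → ℂ := fun x => ∑ s ∈ T, (c s : ℂ) * starRingEnd ℂ (expI s x) with hφ
  have hφc : Continuous φ := by
    refine continuous_finsetSum _ fun s _ => ?_
    exact continuous_const.mul (Complex.continuous_conj.comp (continuous_expI _))
  have hφb : ∀ x, ‖φ x‖ ≤ ∑ s ∈ T, |c s| := fun x => by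
    refine (norm_sum_le _ _).trans (Finset.sum_le_sum fun s _ => ?_)
    rw [norm_mul, RCLike.norm_conj, norm_expI, mul_one, Complex.norm_real, Real.norm_eq_abs]
  have hint : Integrable (fun x => ‖φ x‖ ^ 2 * f x) (volume.restrict freq) := by
    refine hf.bdd_mul (c := (∑ s ∈ T, |c s|) ^ 2) (hφc.norm.pow 2).aestronglyMeasurable
      (ae_of_all _ fun x => ?_)
    rw [Real.norm_eq_abs, abs_of_nonneg (by positivity)]
    exact pow_le_pow_left₀ (norm_nonneg _) (hφb x) 2
  have hnorm : ‖∑ s ∈ T, c s • h (s : ℤ)‖ ^ 2 =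
      ∑ p ∈ T ×ˢ T, c p.1 * c p.2 * A ((p.1 : ℤ) - p.2) := by
    rw [← real_inner_self_eq_norm_sq, sum_inner, Finset.sum_product]
    refine Finset.sum_congr rfl fun t _ => ?_
    rw [inner_sum]
    refine Finset.sum_congr rfl fun s _ => ?_
    rw [real_inner_smul_left, real_inner_smul_right, hA]
    ring
  have hval : ‖∑ s ∈ T, c s • h (s : ℤ)‖ ^ 2 = ∫ x in freq, ‖φ x‖ ^ 2 * f x := by
    have h1 := sum_mul_fourierInt hf (T ×ˢ T) (fun p => (c p.1 * c p.2 : ℂ))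
      (fun p => (p.1 : ℤ) - p.2)
    have h2 : ∀ x, (f x : ℂ) * ∑ p ∈ T ×ˢ T, (c p.1 * c p.2 : ℂ) * expI ((p.1 : ℤ) - p.2) x =
        ((‖φ x‖ ^ 2 * f x : ℝ) : ℂ) := fun x => by
      have h3 : ∑ p ∈ T ×ˢ T, (c p.1 * c p.2 : ℂ) * expI ((p.1 : ℤ) - p.2) x =
          starRingEnd ℂ (φ x) * φ x := by
        simp only [hφ, map_sum]
        rw [← sum_product_mul]
        refine Finset.sum_congr rfl fun p _ => ?_
        simp only [expI_sub, map_mul, Complex.conj_conj, Complex.conj_ofReal]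
        ring
      rw [h3, Complex.conj_mul']
      push_cast
      ring
    simp_rw [h2, ← hA'] at h1
    rw [integral_complex_ofReal] at h1
    rw [hnorm]
    exact_mod_cast h1
  rw [hval, ofReal_integral_eq_lintegral_ofReal hint
    (by filter_upwards [hf0] with x hx; exact mul_nonneg (by positivity) hx)]
  refine lintegral_congr_ae ?_
  filter_upwards [hf0] with x hx
  rw [mul_comm, ENNReal.ofReal_mul (by positivity), ENNReal.ofReal_pow (norm_nonneg _),
    ofReal_norm, Real.enorm_eq_ofReal hx]

/-- The quadratic form of the kernel on unit vectors of the span of the sequence. -/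
theorem exists_quadratic_form_bound (hf : IntegrableOn f freq) (hg : IntegrableOn g freq)
    (hf0 : ∀ᵐ x ∂(volume.restrict freq), 0 ≤ f x)
    (hA : ∀ t s, ⟪h t, h s⟫_ℝ = A (t - s)) (hA' : ∀ k, (A k : ℂ) = fourierInt f k)
    (hG : ∀ k, (G k : ℂ) = fourierInt g k)
    {a b : ℝ} {B₁ B₂ : ℝ≥0∞} (hB₁ : B₁ ≠ ⊤) (hB₂ : B₂ ≠ ⊤)
    (hfa : ∀ᵐ x ∂(volume.restrict freq), ‖f x‖ₑ ≤ B₁ * ‖x‖ₑ ^ (-a))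
    (hgb : ∀ᵐ x ∂(volume.restrict freq), ‖g x‖ₑ ≤ B₂ * ‖x‖ₑ ^ (-b))
    (ha : a < 1) (hb : b < 1) (hab : 0 < a + b) :
    ∃ C : ℝ, ∀ n : ℕ, ∀ e ∈ Submodule.span ℝ ((fun t : ℕ => h t) '' (Finset.Icc 1 n : Finset ℕ)),
      ‖e‖ = 1 → |∑ p ∈ Finset.Icc 1 n ×ˢ Finset.Icc 1 n,
        G ((p.1 : ℤ) - p.2) * (⟪h (p.1 : ℤ), e⟫_ℝ * ⟪h (p.2 : ℤ), e⟫_ℝ)| ≤ C * (n : ℝ) ^ (a + b) := by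
  obtain ⟨C, hC, hS⟩ := exists_schur_bound ha hb hab hB₁ hB₂ (u := fun x => ‖f x‖ₑ)
    (v := fun x => ‖g x‖ₑ) hf.1.enorm hfa hgb
  refine ⟨C.toReal, fun n e he he1 => ?_⟩
  set T := Finset.Icc 1 n with hT
  obtain ⟨c, rfl⟩ := (Submodule.mem_span_image_finset_iff_exists_fun' ℝ).1 he
  set e := ∑ s ∈ T, c s • h (s : ℤ) with he
  set φ : ℝ → ℂ := fun x => ∑ s ∈ T, (c s : ℂ) * starRingEnd ℂ (expI s x) with hφ
  have hφm : Measurable φ := by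
    refine Finset.measurable_sum _ fun s _ => ?_
    exact measurable_const.mul (Complex.continuous_conj.measurable.comp (measurable_expI _))
  have hv : ∀ t : ℕ, ((⟪h (t : ℤ), e⟫_ℝ : ℝ) : ℂ) = ∑ s ∈ T, (c s : ℂ) * fourierInt f ((t : ℤ) - s) := by
    intro t
    rw [he, inner_sum]
    push_cast
    refine Finset.sum_congr rfl fun s _ => ?_
    rw [real_inner_smul_right, hA]
    push_cast
    rw [hA']
  -- Writing each `⟪h t, e⟫` as a Fourier integral against `f` and summing over `t` gives `p(y) = ∫
  -- f(x) φ(x) D_n(x + y) dx`, the operator of Schur's test applied to `φ`.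
  set p : ℝ → ℂ := fun y => ∑ t ∈ T, ((⟪h (t : ℤ), e⟫_ℝ : ℝ) : ℂ) * expI t y with hp
  have hple : ∀ y, ‖p y‖ₑ ≤ ∫⁻ x in freq, ‖f x‖ₑ * ‖φ x‖ₑ * ‖dirichlet n (x + y)‖ₑ := by
    intro y
    have h1 : p y = ∑ q ∈ T ×ˢ T, (expI q.1 y * c q.2) * fourierInt f ((q.1 : ℤ) - q.2) := by
      rw [Finset.sum_product, hp]
      refine Finset.sum_congr rfl fun t _ => ?_
      rw [hv, Finset.sum_mul]
      refine Finset.sum_congr rfl fun s _ => ?_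
      ring
    rw [h1]
    refine (enorm_sum_mul_fourierInt_le hf _ _ _).trans (le_of_eq (lintegral_congr fun x => ?_))
    have h2 : ∑ q ∈ T ×ˢ T, (expI q.1 y * c q.2) * expI ((q.1 : ℤ) - q.2) x =
        dirichlet n (x + y) * φ x := by
      rw [dirichlet_eq_sum_expI, hφ, ← sum_product_mul]
      refine Finset.sum_congr rfl fun q _ => ?_
      rw [expI_sub, expI_add_right]
      ring
    rw [h2, enorm_mul]
    ring
  -- The Toeplitz form of `g` at the vector `(⟪h t, e⟫)_t` equals `∫ g |p|²`.
  have hq : ‖∑ p ∈ T ×ˢ T, G ((p.1 : ℤ) - p.2) * (⟪h (p.1 : ℤ), e⟫_ℝ * ⟪h (p.2 : ℤ), e⟫_ℝ)‖ₑ ≤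
      ∫⁻ y in freq, ‖g y‖ₑ * ‖p y‖ₑ ^ 2 := by
    have hcoe : ∀ z : ℝ, ‖z‖ₑ = ‖(z : ℂ)‖ₑ := fun z => by
      rw [← ofReal_norm, ← ofReal_norm, Complex.norm_real]
    have h1 : ((∑ p ∈ T ×ˢ T,
        G ((p.1 : ℤ) - p.2) * (⟪h (p.1 : ℤ), e⟫_ℝ * ⟪h (p.2 : ℤ), e⟫_ℝ) : ℝ) : ℂ) =
        ∑ p ∈ T ×ˢ T, (((⟪h (p.1 : ℤ), e⟫_ℝ : ℝ) : ℂ) * ((⟪h (p.2 : ℤ), e⟫_ℝ : ℝ) : ℂ)) *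
          fourierInt g ((p.1 : ℤ) - p.2) := by
      push_cast
      refine Finset.sum_congr rfl fun q _ => ?_
      rw [← hG]
      ring
    rw [hcoe, h1]
    refine (enorm_sum_mul_fourierInt_le hg _ _ _).trans (le_of_eq (lintegral_congr fun y => ?_))
    have h2 : ∑ q ∈ T ×ˢ T, (((⟪h (q.1 : ℤ), e⟫_ℝ : ℝ) : ℂ) * ((⟪h (q.2 : ℤ), e⟫_ℝ : ℝ) : ℂ)) *
        expI ((q.1 : ℤ) - q.2) y = p y * starRingEnd ℂ (p y) := by
      simp only [hp, map_sum]
      rw [← sum_product_mul]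
      refine Finset.sum_congr rfl fun q _ => ?_
      simp only [expI_sub, map_mul, Complex.conj_ofReal]
      ring
    rw [h2, enorm_mul, enorm_conj, sq]
  have hfin := calc
    ‖∑ p ∈ T ×ˢ T, G ((p.1 : ℤ) - p.2) * (⟪h (p.1 : ℤ), e⟫_ℝ * ⟪h (p.2 : ℤ), e⟫_ℝ)‖ₑ
      ≤ ∫⁻ y in freq, ‖g y‖ₑ * ‖p y‖ₑ ^ 2 := hq
    _ ≤ ∫⁻ y in freq, ‖g y‖ₑ *
        (∫⁻ x in freq, ‖f x‖ₑ * ‖φ x‖ₑ * ‖dirichlet n (x + y)‖ₑ) ^ 2 := by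
        refine lintegral_mono fun y => ?_
        gcongr
        exact hple y
    _ ≤ C * (n : ℝ≥0∞) ^ (a + b) * ∫⁻ x in freq, ‖f x‖ₑ * ‖φ x‖ₑ ^ 2 :=
        hS n (fun x => ‖φ x‖ₑ) hφm.enorm
    _ = C * (n : ℝ≥0∞) ^ (a + b) := by
        rw [lintegral_enorm_mul_sq_eq_norm_sq hf hf0 hA hA' T c, ← he, he1]
        simp
  have hn : (n : ℝ≥0∞) ^ (a + b) ≠ ⊤ := ENNReal.rpow_ne_top_of_nonneg hab.le (by simp)
  have h3 := ENNReal.toReal_mono (by finiteness) hfin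
  rw [toReal_enorm, Real.norm_eq_abs, ENNReal.toReal_mul, ← ENNReal.toReal_rpow] at h3
  simpa using h3

end Toeplitz

/-! ### The kernel of the integrated periodogram -/

section Kernel

variable {H : Type*} [NormedAddCommGroup H] [InnerProductSpace ℝ H]

/-- The kernel without its normalization `(2π√n)⁻¹`. -/
def rawKernel (h : ℤ → H) (g : ℝ → ℝ) (n : ℕ) : H ⊗[ℝ] H :=
  ∑ p ∈ Finset.Icc 1 n ×ˢ Finset.Icc 1 n,
    (fourierInt g ((p.1 : ℤ) - p.2)).re • (h (p.1 : ℤ) ⊗ₜ[ℝ] h (p.2 : ℤ))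

theorem fourierCoeffOf_re (g : ℝ → ℝ) (k : ℤ) :
    (fourierCoeffOf g k).re = 1 / (2 * Real.pi) * (fourierInt g k).re := by
  rw [fourierCoeffOf_eq, show (1 / (2 * Real.pi) : ℂ) = ((1 / (2 * Real.pi) : ℝ) : ℂ) by push_cast; rfl,
    Complex.re_ofReal_mul]

theorem chaosKernel_eq_smul (h : ℤ → H) (g : ℝ → ℝ) (n : ℕ) :
    chaosKernel h g n = (1 / (2 * Real.pi * √n)) • rawKernel h g n := by
  unfold chaosKernel rawKernel
  rw [Finset.sum_product, Finset.smul_sum, Finset.smul_sum]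
  refine Finset.sum_congr rfl fun t _ => ?_
  rw [Finset.smul_sum, Finset.smul_sum]
  refine Finset.sum_congr rfl fun s _ => ?_
  rw [fourierCoeffOf_re, smul_smul, smul_smul]
  congr 1
  rw [one_div_mul_eq_div, one_div_mul_eq_div, one_div_mul_eq_div, div_div]

theorem fourierInt_re_neg (g : ℝ → ℝ) (k : ℤ) : (fourierInt g (-k)).re = (fourierInt g k).re := by
  rw [fourierInt_neg, Complex.conj_re]

theorem comm_rawKernel (h : ℤ → H) (g : ℝ → ℝ) (n : ℕ) :
    TensorProduct.comm ℝ H H (rawKernel h g n) = rawKernel h g n := by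
  unfold rawKernel
  rw [map_sum]
  refine Finset.sum_nbij' Prod.swap Prod.swap (fun p hp => ?_) (fun p hp => ?_) (fun _ _ => rfl)
    (fun _ _ => rfl) fun p _ => ?_
  · simp only [Finset.mem_product, Prod.fst_swap, Prod.snd_swap] at hp ⊢; tauto
  · simp only [Finset.mem_product, Prod.fst_swap, Prod.snd_swap] at hp ⊢; tauto
  · rw [map_smul, TensorProduct.comm_tmul, Prod.fst_swap, Prod.snd_swap, ← fourierInt_re_neg, neg_sub]

theorem exists_rawKernel_diagonal (h : ℤ → H) (g : ℝ → ℝ) (n : ℕ) :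
    ∃ (m : ℕ) (e : Fin m → H) (lam : Fin m → ℝ), Orthonormal ℝ e ∧
      (∀ i, e i ∈ Submodule.span ℝ ((fun t : ℕ => h t) '' (Finset.Icc 1 n : Finset ℕ))) ∧
      rawKernel h g n = ∑ i, lam i • (e i ⊗ₜ[ℝ] e i) := by
  obtain ⟨m, e, lam, he, hmem, hsum⟩ := exists_diagonalization
    (fun t : Finset.Icc 1 n => h ((t : ℕ) : ℤ))
    (fun t s => (fourierInt g (((t : ℕ) : ℤ) - ((s : ℕ) : ℤ))).re)
    (fun t s => by rw [← fourierInt_re_neg, neg_sub])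
  refine ⟨m, e, lam, he, fun i => ?_, ?_⟩
  · rw [Set.image_eq_range]
    exact hmem i
  · rw [← hsum, rawKernel, Finset.sum_product]
    rw [Finset.sum_coe_sort (Finset.Icc 1 n) fun t : ℕ => ∑ s : Finset.Icc 1 n,
      (fourierInt g ((t : ℤ) - ((s : ℕ) : ℤ))).re • (h (t : ℤ) ⊗ₜ[ℝ] h ((s : ℕ) : ℤ))]
    refine Finset.sum_congr rfl fun t _ => ?_
    rw [Finset.sum_coe_sort (Finset.Icc 1 n) fun s : ℕ =>
      (fourierInt g ((t : ℤ) - (s : ℤ))).re • (h (t : ℤ) ⊗ₜ[ℝ] h (s : ℤ))]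

/-- Pairing both expressions of the kernel with `e i ⊗ e i` isolates `lam i`, so a bound on the form
over unit vectors bounds every eigenvalue. -/
theorem eigenvalue_eq_quadratic_form {h : ℤ → H} {g : ℝ → ℝ} {n m : ℕ} {e : Fin m → H}
    {lam : Fin m → ℝ} (he : Orthonormal ℝ e)
    (hk : rawKernel h g n = ∑ i, lam i • (e i ⊗ₜ[ℝ] e i)) (i : Fin m) :
    lam i = ∑ p ∈ Finset.Icc 1 n ×ˢ Finset.Icc 1 n,
      (fourierInt g ((p.1 : ℤ) - p.2)).re * (⟪h (p.1 : ℤ), e i⟫_ℝ * ⟪h (p.2 : ℤ), e i⟫_ℝ) := by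
  rw [← inner_tmul_self_diagonal he lam i, ← hk, rawKernel, inner_sum]
  refine Finset.sum_congr rfl fun p _ => ?_
  rw [tensor_inner_smul_right, TensorProduct.inner_tmul,
    real_inner_comm (h (p.1 : ℤ)) (e i), real_inner_comm (h (p.2 : ℤ)) (e i)]

theorem norm_sq_contraction_smul (c : ℝ) (k : H ⊗[ℝ] H) :
    ‖contraction (c • k) (c • k)‖ ^ 2 = c ^ 4 * ‖contraction k k‖ ^ 2 := by
  have h1 : contraction (c • k) (c • k) = (c * c) • contraction k k := by
    rw [map_smul, map_smul, LinearMap.smul_apply, smul_smul]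
  have h2 : ‖(c * c) • contraction k k‖ ^ 2 = (c * c) ^ 2 * ‖contraction k k‖ ^ 2 := by
    have h3 : ⟪contraction k k, contraction k k⟫_ℝ = ‖contraction k k‖ ^ 2 :=
      real_inner_self_eq_norm_sq (contraction k k)
    rw [← real_inner_self_eq_norm_sq, tensor_inner_smul_left, tensor_inner_smul_right, h3]
    ring
  rw [h1, h2]
  ring

/-- The contraction is controlled by the spectral and the Hilbert–Schmidt norm of the kernel. -/
theorem norm_sq_contraction_chaosKernel_le {h : ℤ → H} {g : ℝ → ℝ} {n : ℕ} (hn : 1 ≤ n) {Λ S : ℝ}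
    (hΛ : ∀ e ∈ Submodule.span ℝ ((fun t : ℕ => h t) '' (Finset.Icc 1 n : Finset ℕ)),
      ‖e‖ = 1 → |∑ p ∈ Finset.Icc 1 n ×ˢ Finset.Icc 1 n, (fourierInt g ((p.1 : ℤ) - p.2)).re *
        (⟪h (p.1 : ℤ), e⟫_ℝ * ⟪h (p.2 : ℤ), e⟫_ℝ)| ≤ Λ)
    (hS : ‖rawKernel h g n‖ ^ 2 ≤ S) :
    ‖contraction (chaosKernel h g n) (chaosKernel h g n)‖ ^ 2 ≤ (n : ℝ) ^ (-2 : ℝ) * (Λ ^ 2 * S) := by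
  obtain ⟨m, e, lam, he, hmem, hk⟩ := exists_rawKernel_diagonal h g n
  have hnpos : (0 : ℝ) < n := by exact_mod_cast hn
  have hlam : ∀ i, lam i ^ 2 ≤ Λ ^ 2 := fun i => by
    refine sq_le_sq' ?_ ?_ <;>
    · have := abs_le.1 (hΛ (e i) (hmem i) (he.1 i))
      rw [← eigenvalue_eq_quadratic_form he hk i] at this
      linarith [this.1, this.2]
  -- The fourth power of the normalization is `(2π)^(-4) n^(-2)`; the constant, at most `1`, is
  -- dropped.
  have hc : (1 / (2 * Real.pi * √n)) ^ 4 ≤ (n : ℝ) ^ (-2 : ℝ) := by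
    have h1 : (1 : ℝ) ≤ 2 * Real.pi := by linarith [Real.pi_gt_three]
    rw [Real.rpow_neg hnpos.le, Real.rpow_two, div_pow, one_pow, one_div, mul_pow,
      show √(n : ℝ) ^ 4 = (√(n : ℝ) ^ 2) ^ 2 by ring, Real.sq_sqrt hnpos.le]
    gcongr
    have : (1 : ℝ) ≤ (2 * Real.pi) ^ 4 := one_le_pow₀ h1
    nlinarith [sq_nonneg (n : ℝ)]
  rw [chaosKernel_eq_smul, norm_sq_contraction_smul, hk, norm_sq_contraction_diagonal he]
  have hS' : ∑ i, lam i ^ 2 ≤ S := by rw [← norm_sq_diagonal he, ← hk]; exact hS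
  have hsum : ∑ i, lam i ^ 4 ≤ Λ ^ 2 * S := by
    calc ∑ i, lam i ^ 4 ≤ ∑ i, Λ ^ 2 * lam i ^ 2 := by
          refine Finset.sum_le_sum fun i _ => ?_
          rw [show lam i ^ 4 = lam i ^ 2 * lam i ^ 2 by ring]
          exact mul_le_mul_of_nonneg_right (hlam i) (sq_nonneg _)
      _ = Λ ^ 2 * ∑ i, lam i ^ 2 := by rw [Finset.mul_sum]
      _ ≤ _ := by gcongr
  exact mul_le_mul hc hsum (Finset.sum_nonneg fun i _ => by positivity) (by positivity)

end Kernel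

/-! ### The integrated periodogram as a double Wiener–Itô integral -/

section Representation

theorem periodogram_eq_sum {Ω : Type*} (X : ℤ → Ω → ℝ) (n : ℕ) (x : ℝ) (ω : Ω) :
    periodogram X n x ω = 1 / (2 * Real.pi * n) * ∑ p ∈ Finset.Icc 1 n ×ˢ Finset.Icc 1 n,
      X p.1 ω * X p.2 ω * (expI ((p.1 : ℤ) - p.2) x).re := by
  have hpi := Real.pi_pos
  unfold periodogram dft
  set z : ℂ := ∑ t ∈ Finset.Icc 1 n, (X (t : ℤ) ω : ℂ) * Complex.exp (Complex.I * (t : ℂ) * (x : ℂ))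
    with hz
  have h1 : ((‖z‖ ^ 2 : ℝ) : ℂ) = ∑ p ∈ Finset.Icc 1 n ×ˢ Finset.Icc 1 n,
      ((X p.1 ω * X p.2 ω : ℝ) : ℂ) * expI ((p.1 : ℤ) - p.2) x := by
    push_cast
    rw [← Complex.mul_conj', hz, map_sum, ← sum_product_mul]
    refine Finset.sum_congr rfl fun p _ => ?_
    rw [expI_sub, map_mul, Complex.conj_ofReal]
    simp only [expI, Int.cast_natCast]
    ring
  have h2 := congrArg Complex.re h1
  rw [Complex.ofReal_re, Complex.re_sum] at h2
  rw [norm_mul, mul_pow, h2, Complex.norm_real, Real.norm_eq_abs, sq_abs, div_pow,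
    Real.sq_sqrt (by positivity), one_pow]
  congr 1
  refine Finset.sum_congr rfl fun p _ => ?_
  rw [Complex.re_ofReal_mul]

variable {Ω : Type*} [MeasurableSpace Ω] {P : Measure Ω}
  {H : Type*} [NormedAddCommGroup H] [InnerProductSpace ℝ H]

theorem integral_mul_eq_inner {W : H →ₗᵢ[ℝ] Lp ℝ 2 P} {X : ℤ → Ω → ℝ} {h : ℤ → H}
    (hX : ∀ t, X t =ᵐ[P] W (h t)) (t s : ℤ) :
    Integrable (fun ω => X t ω * X s ω) P ∧ ∫ ω, X t ω * X s ω ∂P = ⟪h t, h s⟫_ℝ := by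
  have hm : ∀ t, MemLp (X t) 2 P := fun t => (memLp_congr_ae (hX t)).2 (Lp.memLp (W (h t)))
  refine ⟨(hm t).integrable_mul (hm s), ?_⟩
  rw [← W.inner_map_map, L2.inner_def]
  refine integral_congr_ae ?_
  filter_upwards [hX t, hX s] with ω h1 h2
  rw [h1, h2]
  simp [mul_comm]

theorem integratedPeriodogram_eq_sum {W : H →ₗᵢ[ℝ] Lp ℝ 2 P} {X : ℤ → Ω → ℝ} {h : ℤ → H}
    {g : ℝ → ℝ} (hg : IntegrableOn g freq) (hX : ∀ t, X t =ᵐ[P] W (h t)) (n : ℕ) (ω : Ω) :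
    integratedPeriodogram P X g n ω =
      1 / (2 * Real.pi * √n) * ∑ p ∈ Finset.Icc 1 n ×ˢ Finset.Icc 1 n,
        (fourierInt g ((p.1 : ℤ) - p.2)).re *
          (X p.1 ω * X p.2 ω - ⟪h (p.1 : ℤ), h (p.2 : ℤ)⟫_ℝ) := by
  have hpi := Real.pi_pos
  set T := Finset.Icc 1 n
  have hmean : ∀ x, ∫ ω', periodogram X n x ω' ∂P = 1 / (2 * Real.pi * n) * ∑ p ∈ T ×ˢ T,
      ⟪h (p.1 : ℤ), h (p.2 : ℤ)⟫_ℝ * (expI ((p.1 : ℤ) - p.2) x).re := fun x => by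
    simp_rw [periodogram_eq_sum]
    rw [integral_const_mul, integral_finsetSum _ fun p _ =>
      (integral_mul_eq_inner hX p.1 p.2).1.mul_const _]
    congr 1
    refine Finset.sum_congr rfl fun p _ => ?_
    rw [integral_mul_const, (integral_mul_eq_inner hX p.1 p.2).2]
  have hre : ∀ k, Integrable (fun x => g x * (expI k x).re) (volume.restrict freq) ∧
      ∫ x in freq, g x * (expI k x).re = (fourierInt g k).re := fun k => by
    have h1 := integrable_expI_mul hg k
    have h2 : ∀ x, g x * (expI k x).re = (expI k x * (g x : ℂ)).re := fun x => by
      rw [Complex.re_mul_ofReal, mul_comm]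
    simp_rw [h2]
    exact ⟨h1.re, integral_re h1⟩
  have hint : ∫ x in (-Real.pi)..Real.pi,
      g x * (periodogram X n x ω - ∫ ω', periodogram X n x ω' ∂P) =
      1 / (2 * Real.pi * n) * ∑ p ∈ T ×ˢ T, (fourierInt g ((p.1 : ℤ) - p.2)).re *
        (X p.1 ω * X p.2 ω - ⟪h (p.1 : ℤ), h (p.2 : ℤ)⟫_ℝ) := by
    rw [intervalIntegral.integral_of_le (by linarith), integral_Ioc_eq_integral_Ioo]
    have h1 : ∀ x, g x * (periodogram X n x ω - ∫ ω', periodogram X n x ω' ∂P) =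
        1 / (2 * Real.pi * n) * ∑ p ∈ T ×ˢ T, (g x * (expI ((p.1 : ℤ) - p.2) x).re) *
          (X p.1 ω * X p.2 ω - ⟪h (p.1 : ℤ), h (p.2 : ℤ)⟫_ℝ) := fun x => by
      rw [hmean, periodogram_eq_sum, ← mul_sub, ← Finset.sum_sub_distrib, mul_left_comm, Finset.mul_sum]
      congr 1
      refine Finset.sum_congr rfl fun p _ => ?_
      ring
    simp_rw [h1]
    rw [integral_const_mul, integral_finsetSum _ fun p _ => (hre _).1.mul_const _]
    congr 1
    refine Finset.sum_congr rfl fun p _ => ?_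
    rw [integral_mul_const, (hre _).2]
  unfold integratedPeriodogram
  rw [hint, ← mul_assoc]
  congr 1
  -- For `n = 0` both prefactors are `0`, because division by zero gives zero.
  rcases Nat.eq_zero_or_pos n with rfl | hn
  · simp
  · have hnpos : (0 : ℝ) < n := by exact_mod_cast hn
    have hs : √(n : ℝ) ≠ 0 := (Real.sqrt_pos.2 hnpos).ne'
    rw [mul_one_div, div_eq_div_iff (by positivity) (by positivity)]
    nlinarith [Real.mul_self_sqrt hnpos.le]

theorem integratedPeriodogram_ae_eq_wienerIntegral₂ {W : H →ₗᵢ[ℝ] Lp ℝ 2 P} {X : ℤ → Ω → ℝ}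
    {h : ℤ → H} {g : ℝ → ℝ} (hg : IntegrableOn g freq) (hX : ∀ t, X t =ᵐ[P] W (h t)) (n : ℕ) :
    integratedPeriodogram P X g n =ᵐ[P] wienerIntegral₂ W (chaosKernel h g n) := by
  rw [chaosKernel_eq_smul, map_smul]
  filter_upwards [AEEqFun.coeFn_smul (1 / (2 * Real.pi * √n)) (wienerIntegral₂ W (rawKernel h g n)),
    wienerIntegral₂_sum_ae W (Finset.Icc 1 n ×ˢ Finset.Icc 1 n)
      (fun p : ℕ × ℕ => (fourierInt g ((p.1 : ℤ) - p.2)).re) (fun p => h (p.1 : ℤ))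
      (fun p => h (p.2 : ℤ)), ae_all_iff.2 hX] with ω h1 h2 h3
  rw [h1, Pi.smul_apply, rawKernel, h2, integratedPeriodogram_eq_sum hg hX, smul_eq_mul]
  simp_rw [h3]

theorem fourthCumulant_integratedPeriodogram [IsProbabilityMeasure P] {W : H →ₗᵢ[ℝ] Lp ℝ 2 P}
    (hW : IsIsonormal W) {X : ℤ → Ω → ℝ} {h : ℤ → H} {g : ℝ → ℝ} (hg : IntegrableOn g freq)
    (hX : ∀ t, X t =ᵐ[P] W (h t)) (n : ℕ) :
    MemLp (integratedPeriodogram P X g n) 4 P ∧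
      fourthCumulant P (integratedPeriodogram P X g n) =
        48 * ‖contraction (chaosKernel h g n) (chaosKernel h g n)‖ ^ 2 := by
  have hae := integratedPeriodogram_ae_eq_wienerIntegral₂ hg hX n
  obtain ⟨m, e, lam, he, -, hk⟩ := exists_rawKernel_diagonal h g n
  have hk' : chaosKernel h g n = ∑ i, (1 / (2 * Real.pi * √n) * lam i) • (e i ⊗ₜ[ℝ] e i) := by
    rw [chaosKernel_eq_smul, hk, Finset.smul_sum]
    simp_rw [smul_smul]
  have hcum := fourthCumulant_wienerIntegral₂_diagonal hW he fun i => 1 / (2 * Real.pi * √n) * lam i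
  rw [← hk'] at hcum
  refine ⟨(memLp_congr_ae hae).2 hcum.1, ?_⟩
  rw [fourthCumulant_congr hae, hcum.2, hk', norm_sq_contraction_diagonal he]

end Representation

/-! ### The rate of the contraction -/

section Rate

variable {H : Type*} [NormedAddCommGroup H] [InnerProductSpace ℝ H]

/-- The spectral bound `n^(a+b)` and the Hilbert–Schmidt bound `n^(1+2ε)` are combined with `a + b =
D + 2ε`. The total exponent is `-2 + 2(D + 2ε) + (1 + 2ε) = 2D - 1 + 6ε`. -/
theorem exists_contraction_bound {f g Lf Lg : ℝ → ℝ} {α β : ℝ}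
    (hf_int : IntegrableOn f freq) (hg_int : IntegrableOn g freq)
    (hf_nonneg : ∀ᵐ x ∂(volume.restrict freq), 0 ≤ f x) (hg_even : EvenAE g)
    (hf : PowerLawAtZero f Lf α) (hg : PowerLawAtZero g Lg β)
    (hf_bdd : BoundedAwayFromZero f) (hg_bdd : BoundedAwayFromZero g)
    (hα : -1 < α) (hα' : α < 1) (hβ : -1 < β) (hβ' : β < 1) (hd : α + β < 1 / 2)
    {h : ℤ → H} (hcov : ∀ t s : ℤ, ((⟪h t, h s⟫_ℝ : ℝ) : ℂ) = fourierInt f (t - s))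
    {η : ℝ} (hη : 0 < η) :
    ∃ C : ℝ, ∀ n : ℕ, 1 ≤ n → ‖contraction (chaosKernel h g n) (chaosKernel h g n)‖ ^ 2 ≤
      C * (n : ℝ) ^ (2 * max (α + β) 0 - 1 + η) := by
  set A : ℤ → ℝ := fun k => ⟪h k, h 0⟫_ℝ with hAdef
  have hA' : ∀ k, (A k : ℂ) = fourierInt f k := fun k => by rw [hAdef, hcov, sub_zero]
  have hA : ∀ t s, ⟪h t, h s⟫_ℝ = A (t - s) := fun t s => by
    have h1 : ((⟪h t, h s⟫_ℝ : ℝ) : ℂ) = (A (t - s) : ℂ) := by rw [hcov, hA']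
    exact_mod_cast h1
  have hG := hg_even.ofReal_re_fourierInt
  set D := max (α + β) 0 with hD
  -- When `α + β < 0`, both exponents are raised by `μ` so that their sum becomes `0`; otherwise `μ
  -- = 0`.
  set μ := max (-(α + β)) 0 / 2 with hμ
  have hDμ : α + β + 2 * μ = D := by
    rw [hD, hμ]
    rcases le_total (α + β) 0 with h0 | h0
    · rw [max_eq_right h0, max_eq_left (by linarith)]; ring
    · rw [max_eq_left h0, max_eq_right (by linarith)]; ring
  have hμ0 : 0 ≤ μ := by positivity
  have hD0 : 0 ≤ D := le_max_right _ _
  have hD2 : D < 1 / 2 := max_lt hd (by norm_num)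
  -- If `α + β ≤ 0` then `α + μ = (α - β)/2`, so the lower bound `β > -1` is what keeps it below
  -- `1`.
  have hαμ : α + μ < 1 := by
    rcases le_total (α + β) 0 with h0 | h0
    · rw [hμ, max_eq_left (by linarith)]; linarith
    · rw [hμ, max_eq_right (by linarith)]; linarith
  have hβμ : β + μ < 1 := by
    rcases le_total (α + β) 0 with h0 | h0
    · rw [hμ, max_eq_left (by linarith)]; linarith
    · rw [hμ, max_eq_right (by linarith)]; linarith
  -- The four upper bounds on `ε` ensure, in order, `a < 1`, `b < 1`, `a + b = D + 2ε < 1/2` and `6ε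
  -- < η`.
  obtain ⟨ε, hε, hεlt⟩ : ∃ ε : ℝ, 0 < ε ∧
      ε < min (min (1 - (α + μ)) (1 - (β + μ))) (min ((1 / 2 - D) / 2) (η / 6)) := by
    refine exists_between (lt_min (lt_min ?_ ?_) (lt_min ?_ ?_)) <;> linarith
  simp only [lt_min_iff] at hεlt
  obtain ⟨⟨hε1, hε2⟩, hε3, hε4⟩ := hεlt
  set a := α + μ + ε with ha
  set b := β + μ + ε with hb
  obtain ⟨B₁, hB₁, hfa⟩ := hf.exists_enorm_le hf_bdd (a' := a) (by linarith)
  obtain ⟨B₂, hB₂, hgb⟩ := hg.exists_enorm_le hg_bdd (a' := b) (by linarith)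
  obtain ⟨C₁, hC₁⟩ := exists_quadratic_form_bound hf_int hg_int hf_nonneg hA hA' hG hB₁ hB₂ hfa hgb
    (by linarith) (by linarith) (by linarith)
  obtain ⟨C₂, hC₂⟩ : ∃ C₂ : ℝ, ∀ n : ℕ,
      ‖rawKernel h g n‖ ^ 2 ≤ C₂ * (n : ℝ) ^ (4 * (1 / 4 + ε / 2)) := by
    -- The cyclic estimate with `θ = 1/4 + ε/2` needs `ε/2 < 3/4` times the exponent of the outer
    -- weight. The larger of `a` and `b` is at least `(a + b)/2 ≥ ε`, so the corresponding density
    -- is taken as outer weight.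
    rcases le_total a b with hle | hle
    · obtain ⟨C, hC⟩ := exists_cyclic_sum_bound hg_int hf_int hG hA' hB₂ hB₁ hgb hfa
        (θ := 1 / 4 + ε / 2) (by linarith) (by linarith) (by linarith) (by linarith) (by linarith)
      refine ⟨C, fun n => ?_⟩
      rw [rawKernel, inner_sum_sum_tmul hA (fun k => (fourierInt g k).re)]
      exact (le_abs_self _).trans (hC n)
    · obtain ⟨C, hC⟩ := exists_cyclic_sum_bound hf_int hg_int hA' hG hB₁ hB₂ hfa hgb
        (θ := 1 / 4 + ε / 2) (by linarith) (by linarith) (by linarith) (by linarith) (by linarith)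
      refine ⟨C, fun n => ?_⟩
      rw [rawKernel, inner_sum_sum_tmul hA (fun k => (fourierInt g k).re)]
      exact (cyclic_sum_symm A (fun k => (fourierInt g k).re) n).le.trans
        ((le_abs_self _).trans (hC n))
  refine ⟨C₁ ^ 2 * C₂, fun n hn => ?_⟩
  have hnpos : (0 : ℝ) < n := by exact_mod_cast hn
  have hn1 : (1 : ℝ) ≤ n := by exact_mod_cast hn
  have hC₂0 : 0 ≤ C₂ := by
    have := (sq_nonneg _).trans (hC₂ 1)
    simpa using this
  refine (norm_sq_contraction_chaosKernel_le hn (hC₁ n) (hC₂ n)).trans ?_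
  calc (n : ℝ) ^ (-2 : ℝ) * ((C₁ * (n : ℝ) ^ (a + b)) ^ 2 * (C₂ * (n : ℝ) ^ (4 * (1 / 4 + ε / 2))))
      = C₁ ^ 2 * C₂ * ((n : ℝ) ^ (-2 : ℝ) * ((n : ℝ) ^ (a + b) * (n : ℝ) ^ (a + b)) *
          (n : ℝ) ^ (4 * (1 / 4 + ε / 2))) := by ring
    _ = C₁ ^ 2 * C₂ * (n : ℝ) ^ (2 * D - 1 + 6 * ε) := by
        rw [← Real.rpow_add hnpos, ← Real.rpow_add hnpos, ← Real.rpow_add hnpos]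
        congr 2
        rw [← hDμ, ha, hb]
        ring
    _ ≤ C₁ ^ 2 * C₂ * (n : ℝ) ^ (2 * D - 1 + η) := by
        gcongr
        linarith

end Rate

end IntegratedPeriodogram

end

open IntegratedPeriodogram in
theorem mainTheorem4
    {Ω : Type*} [MeasurableSpace Ω] (P : Measure Ω) [IsProbabilityMeasure P]
    {H : Type*} [NormedAddCommGroup H] [InnerProductSpace ℝ H]
    (W : H →ₗᵢ[ℝ] Lp ℝ 2 P) (hW : IsIsonormal W)
    (f g Lf Lg : ℝ → ℝ) (α β : ℝ)
    (hf_int : IntegrableOn f (Set.Ioo (-Real.pi) Real.pi))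
    (hg_int : IntegrableOn g (Set.Ioo (-Real.pi) Real.pi))
    (hf_nonneg : ∀ᵐ x ∂(volume.restrict (Set.Ioo (-Real.pi) Real.pi)), 0 ≤ f x)
    (hf_even : EvenAE f) (hg_even : EvenAE g)
    (hf : PowerLawAtZero f Lf α) (hg : PowerLawAtZero g Lg β)
    (hf_bdd : BoundedAwayFromZero f) (hg_bdd : BoundedAwayFromZero g)
    (hα : -1 < α) (hα' : α < 1) (hβ : -1 < β) (hβ' : β < 1) (hd : α + β < 1 / 2)
    -- the stationary Gaussian sequence `X_t = W(h_t)` with spectral density `f`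
    (X : ℤ → Ω → ℝ) (h : ℤ → H) (hX : ∀ t, X t =ᵐ[P] W (h t))
    (hcov : ∀ t s : ℤ, ((inner ℝ (h t) (h s) : ℝ) : ℂ) =
      ∫ x in (-Real.pi)..Real.pi,
        Complex.exp (Complex.I * ((t - s : ℤ) : ℂ) * (x : ℂ)) * (f x : ℂ)) :
    -- `k_n` is the symmetric kernel of `F_n`
    (∀ n : ℕ, TensorProduct.comm ℝ H H (chaosKernel h g n) = chaosKernel h g n ∧
      integratedPeriodogram P X g n =ᵐ[P] wienerIntegral₂ W (chaosKernel h g n)) ∧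
    -- the contraction is proportional to the fourth cumulant
    (∀ n : ℕ, MemLp (integratedPeriodogram P X g n) 4 P ∧
      fourthCumulant P (integratedPeriodogram P X g n) =
        48 * ‖contraction (chaosKernel h g n) (chaosKernel h g n)‖ ^ 2) ∧
    -- the contraction vanishes asymptotically
    Tendsto (fun n : ℕ => ‖contraction (chaosKernel h g n) (chaosKernel h g n)‖ ^ 2)
      atTop (𝓝 0) ∧
    -- rate under local smoothness
    (LocallySmooth f → LocallySmooth g → ∀ η : ℝ, 0 < η → ∃ C : ℝ, ∀ᶠ n : ℕ in atTop,
      ‖contraction (chaosKernel h g n) (chaosKernel h g n)‖ ^ 2 ≤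
        C * (n : ℝ) ^ (2 * max (α + β) 0 - 1 + η)) := by
  have hfac : ∀ t s : ℤ, ((inner ℝ (h t) (h s) : ℝ) : ℂ) = fourierInt f (t - s) := fun t s => by
    rw [hcov, intervalIntegral_eq_setIntegral_freq]
    rfl
  have hbound : ∀ η : ℝ, 0 < η → ∃ C : ℝ, ∀ n : ℕ, 1 ≤ n →
      ‖contraction (chaosKernel h g n) (chaosKernel h g n)‖ ^ 2 ≤
        C * (n : ℝ) ^ (2 * max (α + β) 0 - 1 + η) := fun η hη =>
    exists_contraction_bound hf_int hg_int hf_nonneg hg_even hf hg hf_bdd hg_bdd hα hα' hβ hβ' hd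
      hfac hη
  refine ⟨fun n => ⟨?_, integratedPeriodogram_ae_eq_wienerIntegral₂ hg_int hX n⟩,
    fun n => fourthCumulant_integratedPeriodogram hW hg_int hX n, ?_, fun _ _ η hη => ?_⟩
  · rw [chaosKernel_eq_smul, map_smul, comm_rawKernel]
  · have hmax : max (α + β) 0 < 1 / 2 := max_lt hd (by norm_num)
    -- Half of the gap `1 - 2 max(d, 0) > 0` is spent as `η`, which leaves the decay `n^(-γ)`.
    set γ := (1 - 2 * max (α + β) 0) / 2 with hγ
    have hγ0 : 0 < γ := by linarith
    obtain ⟨C, hC⟩ := hbound γ hγ0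
    have hlim : Tendsto (fun n : ℕ => C * (n : ℝ) ^ (-γ)) atTop (𝓝 0) := by
      simpa using ((tendsto_rpow_neg_atTop hγ0).comp tendsto_natCast_atTop_atTop).const_mul C
    refine squeeze_zero' (Eventually.of_forall fun n => sq_nonneg _) ?_ hlim
    filter_upwards [eventually_ge_atTop 1] with n hn
    have := hC n hn
    rwa [show 2 * max (α + β) 0 - 1 + γ = -γ by rw [hγ]; ring] at this
  · obtain ⟨C, hC⟩ := hbound η hη
    refine ⟨C, ?_⟩
    filter_upwards [eventually_ge_atTop 1] with n hn
    exact hC n hn
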